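/- **Setting.** Let $\Omega\subset\mathbb R^2$ be open, bounded and connected. Vector fields on $\Omega$ have three components and do not depend on $z$ (so $\partial/\partial z=0$ in $\nabla$, $\nabla\cdot$, $\nabla\times$). All derivatives are weak, $\langle\cdot,\cdot\rangle$ denotes the $L^2(\Omega)$ or $L^2(\Omega)^3$ inner product, and $\|v\|_{DC}^2=\|v\|^2+\|\nabla\cdot v\|^2+\|\nabla\times v\|^2$. Let $K_1\in\mathbb R$, $K_2,K_3>0$, $\kappa=K_2/K_3$, $\epsilon_0,\epsilon_\parallel,\epsilon_\perp>0$, $\epsilon_a=\epsilon_\parallel-\epsilon_\perp$, $e_s,e_b\in\mathbb R$. Let $(n_k,\phi_k,\lambda_k)$ be a current iterate: $n_k\in H(\mathrm{div},\Omega)\cap H(\mathrm{curl},\Omega)$ is continuous and nowhere zero on $\Omega$, with $|n_k|^2\le\beta$ on $\Omega$; $\phi_k\in H^1(\Omega)$ with $C_\phi=\sup_\Omega|\nabla\phi_k|<\infty$ (essential supremum); $\lambda_k\in L^2(\Omega)$. Put $Z=I-(1-\kappa)\,n_k\otimes n_k$ and $$\begin{aligned} \tilde a(u,v)={}&K_1\langle\nabla\cdot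 u,\nabla\cdot v\rangle+K_3\langle Z\,\nabla\times u,\nabla\times v\rangle+(K_2-K_3)\big(\langle u\cdot\nabla\times v,\,n_k\cdot\nabla\times n_k\rangle+\langle n_k\cdot\nabla\times v,\,u\cdot\nabla\times n_k\rangle\\ &+\langle n_k\cdot\nabla\times n_k,\,v\cdot\nabla\times u\rangle+\langle n_k\cdot\nabla\times u,\,v\cdot\nabla\times n_k\rangle+\langle u\cdot\nabla\times n_k,\,v\cdot\nabla\times n_k\rangle\big)+\int_\Omega\lambda_k\,(u\cdot v),\\ a(u,v)={}&\tilde a(u,v)-\epsilon_0\epsilon_a\langle u\cdot\nabla\phi_k,v\cdot\nabla\phi_k\rangle+e_s\big(\langle\nabla\cdot u,v\cdot\nabla\phi_k\rangle+\langle\nabla\cdot v,u\cdot\nabla\phi_k\rangle\big)\\ &+e_b\big(\langle u\times\nabla\times v,\nabla\phi_k\rangle+\langle v\times\nabla\times u,\nabla\phi_k\rangle\big),\\ d(v,\psi)={}&-\epsilon_0\epsilon_a\langle n_k\cdot\nabla\phi_k,v\cdot\nabla\psi\rangle-\epsilon_0\epsilon_a\langle v\cdot\nabla\phi_k,n_k\cdot\nabla\psi\rangle+e_s\big(\langle\nabla\cdot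 v,n_k\cdot\nabla\psi\rangle+\langle\nabla\cdot n_k,v\cdot\nabla\psi\rangle\big)\\ &+e_b\big(\langle n_k\times\nabla\times v,\nabla\psi\rangle+\langle v\times\nabla\times n_k,\nabla\psi\rangle\big),\\ b(v,\gamma)={}&\int_\Omega\gamma\,(n_k\cdot v),\qquad c(\chi,\psi)=\epsilon_0\epsilon_\perp\langle\nabla\chi,\nabla\psi\rangle+\epsilon_0\epsilon_a\langle n_k\cdot\nabla\chi,n_k\cdot\nabla\psi\rangle. \end{aligned}$$ These are (up to the common factor $2$, and a sign for $c$) the second derivatives at $(n_k,\phi_k,\lambda_k)$ of the flexoelectric Frank–Oseen Lagrangian under Dirichlet conditions. Let $\mathcal T_h$ be a finite subdivision of $\Omega$ into nondegenerate convex quadrilaterals: the open cells are pairwise disjoint and contained in $\Omega$, and the closed cells cover $\overline\Omega$. Let $m\ge1$; let $Q_m$ be the functions continuous on $\overline\Omega$ whose pullback to $[0,1]^2$ by the bilinear reference map of each cell is a polynomial of degree at most $m$ in each variable; let $b_T$ be the biquadratic bubble of the cell $T$, which vanishes on $\partial T$; let $V_h^b$ be the fields $v$, continuous on $\overline\Omega$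 and zero on $\partial\Omega$, with $v|_T=a_Tb_Tn_k|_T$, $a_T\in\mathbb R$, for all $T\in\mathcal T_h$. Put $V_h=\{v\in Q_m^3+V_h^b:\ v=0\text{ on }\partial\Omega\}$, let $\Pi_h=P_0$ be the space of functions constant on each cell, and let $\Phi_h$ be any finite-dimensional subspace of $H^1_0(\Omega)$. **Theorem.** Assume that 1. $\epsilon_a\ge0$, or $\epsilon_a<0$ and $\beta<\epsilon_\perp/|\epsilon_a|$; 2. $\alpha_0>0$ is such that $\tilde a(v,v)\ge\alpha_0\|v\|_{DC}^2$ for all $v\in V_h$; 3. $\epsilon_a\le0$ and $\alpha_0>2C_\phi(|e_b|+|e_s|)$, or $\epsilon_a>0$ and $\alpha_0>\epsilon_0\epsilon_aC_\phi^2+2C_\phi(|e_b|+|e_s|)$. Then, for any bases $(v_i)$ of $V_h$, $(\psi_i)$ of $\Phi_h$ and $(\gamma_i)$ of $\Pi_h$, the matrix $$\bar M=\begin{pmatrix}\bar A&\bar B_1&B_2\\ \bar B_1^T&-\tilde C&0\\ B_2^T&0&0\end{pmatrix},\qquad \bar A_{ij}=a(v_j,v_i),\quad(\bar B_1)_{ij}=d(v_i,\psi_j),\quad(B_2)_{ij}=b(v_i,\gamma_j),\quad\tilde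 C_{ij}=c(\psi_j,\psi_i),$$ is invertible. -/

import Mathlib

open MeasureTheory Filter Topology Matrix
open scoped ContDiff ENNReal

noncomputable section

namespace Flexo

/-- The plane containing the (cross-section of the) sample. -/
abbrev Plane : Type := EuclideanSpace ℝ (Fin 2)

/-- Values of vector fields. Fields on the planar domain have three components `(x, y, z)` and do
not depend on `z`. Euclidean products are written with `⬝ᵥ`, so the sup norm of `Fin 3 → ℝ` is
never used as the length of a vector. -/
abbrev Vec : Type := Fin 3 → ℝ

/-! ### Classical and weak first-order differential operators (with `∂/∂z = 0`) -/

/-- Classical partial derivative; `pd 0 = ∂/∂x`, `pd 1 = ∂/∂y`. -/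
def pd (i : Fin 2) (f : Plane → ℝ) (x : Plane) : ℝ :=
  fderiv ℝ f x (EuclideanSpace.single i 1)

/-- Classical gradient `(∂ₓ f, ∂ᵧ f, 0)`. -/
def cgrad (f : Plane → ℝ) (x : Plane) : Vec := ![pd 0 f x, pd 1 f x, 0]

/-- Classical divergence `∂ₓ w₁ + ∂ᵧ w₂`. -/
def cdiv (w : Plane → Vec) (x : Plane) : ℝ :=
  pd 0 (fun y ↦ w y 0) x + pd 1 (fun y ↦ w y 1) x

/-- Classical curl `(∂ᵧ w₃, -∂ₓ w₃, ∂ₓ w₂ - ∂ᵧ w₁)`. -/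
def ccurl (w : Plane → Vec) (x : Plane) : Vec :=
  ![pd 1 (fun y ↦ w y 2) x, - pd 0 (fun y ↦ w y 2) x,
    pd 0 (fun y ↦ w y 1) x - pd 1 (fun y ↦ w y 0) x]

/-- Scalar test functions `C_c^∞(Ω)`. -/
def IsTest (Ω : Set Plane) (η : Plane → ℝ) : Prop :=
  ContDiff ℝ ∞ η ∧ HasCompactSupport η ∧ tsupport η ⊆ Ω

/-- Test vector fields `C_c^∞(Ω)³`. -/
def IsTestField (Ω : Set Plane) (w : Plane → Vec) : Prop :=
  ∀ i : Fin 3, IsTest Ω (fun x ↦ w x i)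

/-- `g ∈ L²(Ω)³` is the weak gradient of `f` on `Ω`. -/
def IsWeakGrad (Ω : Set Plane) (f : Plane → ℝ) (g : Plane → Vec) : Prop :=
  MemLp g 2 (volume.restrict Ω) ∧
    ∀ w, IsTestField Ω w → ∫ x in Ω, f x * cdiv w x = - ∫ x in Ω, g x ⬝ᵥ w x

/-- `d ∈ L²(Ω)` is the weak divergence of `v` on `Ω`. -/
def IsWeakDiv (Ω : Set Plane) (v : Plane → Vec) (d : Plane → ℝ) : Prop :=
  MemLp d 2 (volume.restrict Ω) ∧
    ∀ η, IsTest Ω η → ∫ x in Ω, v x ⬝ᵥ cgrad η x = - ∫ x in Ω, d x * η x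

/-- `c ∈ L²(Ω)³` is the weak curl of `v` on `Ω`. -/
def IsWeakCurl (Ω : Set Plane) (v : Plane → Vec) (c : Plane → Vec) : Prop :=
  MemLp c 2 (volume.restrict Ω) ∧
    ∀ w, IsTestField Ω w → ∫ x in Ω, v x ⬝ᵥ ccurl w x = ∫ x in Ω, c x ⬝ᵥ w x

open Classical in
/-- The weak gradient (unique a.e. on `Ω`; `0` if there is none in `L²`). -/
def wgrad (Ω : Set Plane) (f : Plane → ℝ) : Plane → Vec :=
  if h : ∃ g, IsWeakGrad Ω f g then h.choose else 0

open Classical in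
/-- The weak divergence (unique a.e. on `Ω`; `0` if there is none in `L²`). -/
def wdiv (Ω : Set Plane) (v : Plane → Vec) : Plane → ℝ :=
  if h : ∃ d, IsWeakDiv Ω v d then h.choose else 0

open Classical in
/-- The weak curl (unique a.e. on `Ω`; `0` if there is none in `L²`). -/
def wcurl (Ω : Set Plane) (v : Plane → Vec) : Plane → Vec :=
  if h : ∃ c, IsWeakCurl Ω v c then h.choose else 0

/-! ### Function spaces -/

/-- Membership in `H¹(Ω)`. -/
def IsH1 (Ω : Set Plane) (f : Plane → ℝ) : Prop :=
  MemLp f 2 (volume.restrict Ω) ∧ ∃ g, IsWeakGrad Ω f g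

/-- Membership in `H¹₀(Ω)`, the closure of `C_c^∞(Ω)` in `H¹(Ω)`. -/
def IsH10 (Ω : Set Plane) (f : Plane → ℝ) : Prop :=
  IsH1 Ω f ∧ ∃ η : ℕ → Plane → ℝ, (∀ j, IsTest Ω (η j)) ∧
    Tendsto (fun j ↦ eLpNorm (fun x ↦ η j x - f x) 2 (volume.restrict Ω)) atTop (𝓝 0) ∧
    Tendsto (fun j ↦ eLpNorm (fun x ↦ cgrad (η j) x - wgrad Ω f x) 2 (volume.restrict Ω))
      atTop (𝓝 0)

/-- Membership in `H(div, Ω) ∩ H(curl, Ω)`. -/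
def IsHDC (Ω : Set Plane) (v : Plane → Vec) : Prop :=
  MemLp v 2 (volume.restrict Ω) ∧ (∃ d, IsWeakDiv Ω v d) ∧ ∃ c, IsWeakCurl Ω v c

/-- `L²(Ω)` inner product of scalar functions. -/
def ip (Ω : Set Plane) (f g : Plane → ℝ) : ℝ := ∫ x in Ω, f x * g x

/-- `L²(Ω)³` inner product of vector fields. -/
def ipv (Ω : Set Plane) (f g : Plane → Vec) : ℝ := ∫ x in Ω, f x ⬝ᵥ g x

/-- The squared norm of `H(div, Ω) ∩ H(curl, Ω)`. -/
def normDCsq (Ω : Set Plane) (v : Plane → Vec) : ℝ :=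
  ipv Ω v v + ip Ω (wdiv Ω v) (wdiv Ω v) + ipv Ω (wcurl Ω v) (wcurl Ω v)

/-! ### Material constants and the current Newton iterate -/

/-- Material constants: Frank constants (`K₄` only enters through a null Lagrangian, which is
dropped under Dirichlet conditions), permittivity of free space, parallel and perpendicular
dielectric permittivities, and the flexoelectric constants. -/
structure Material where
  K₁ : ℝ
  K₂ : ℝ
  K₃ : ℝ
  ε₀ : ℝ
  εpar : ℝ
  εperp : ℝ
  es : ℝ
  eb : ℝ
  K₂_pos : 0 < K₂
  K₃_pos : 0 < K₃
  ε₀_pos : 0 < ε₀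
  εpar_pos : 0 < εpar
  εperp_pos : 0 < εperp

/-- Dielectric anisotropy. -/
def Material.εa (p : Material) : ℝ := p.εpar - p.εperp

/-- The ratio `κ = K₂ / K₃`. -/
def Material.κ (p : Material) : ℝ := p.K₂ / p.K₃

/-- A current approximation `(n_k, φ_k, λ_k)`. -/
structure Iterate where
  n : Plane → Vec
  φ : Plane → ℝ
  lam : Plane → ℝ

/-- `Z(n) = I - (1 - κ) n ⊗ n`. -/
def Zmat (p : Material) (n : Vec) : Matrix (Fin 3) (Fin 3) ℝ :=
  1 - (1 - p.κ) • Matrix.vecMulVec n n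

/-- `sup_Ω |∇φ|`, as an extended number (essential supremum, since `∇φ` is a weak gradient). -/
def gradSup (Ω : Set Plane) (φ : Plane → ℝ) : ℝ≥0∞ :=
  eLpNorm (fun x ↦ Real.sqrt (wgrad Ω φ x ⬝ᵥ wgrad Ω φ x)) ∞ (volume.restrict Ω)

/-! ### Bilinear forms of the Newton linearization

All second derivatives of the flexoelectric Lagrangian carry a common factor `2`, which is
divided out. The state is `k = (n_k, φ_k, λ_k)`. -/

/-- Free elastic part of the second derivative with respect to `n`. -/
def aElastic (p : Material) (Ω : Set Plane) (k : Iterate) (u v : Plane → Vec) : ℝ :=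
  p.K₁ * ip Ω (wdiv Ω u) (wdiv Ω v)
  + p.K₃ * ipv Ω (fun x ↦ Zmat p (k.n x) *ᵥ wcurl Ω u x) (wcurl Ω v)
  + (p.K₂ - p.K₃) *
    (ip Ω (fun x ↦ u x ⬝ᵥ wcurl Ω v x) (fun x ↦ k.n x ⬝ᵥ wcurl Ω k.n x)
    + ip Ω (fun x ↦ k.n x ⬝ᵥ wcurl Ω v x) (fun x ↦ u x ⬝ᵥ wcurl Ω k.n x)
    + ip Ω (fun x ↦ k.n x ⬝ᵥ wcurl Ω k.n x) (fun x ↦ v x ⬝ᵥ wcurl Ω u x)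
    + ip Ω (fun x ↦ k.n x ⬝ᵥ wcurl Ω u x) (fun x ↦ v x ⬝ᵥ wcurl Ω k.n x)
    + ip Ω (fun x ↦ u x ⬝ᵥ wcurl Ω k.n x) (fun x ↦ v x ⬝ᵥ wcurl Ω k.n x))
  + ∫ x in Ω, k.lam x * (u x ⬝ᵥ v x)

/-- The form `a(u, v)`: second derivative of the flexoelectric Lagrangian with respect to `n`. -/
def aForm (p : Material) (Ω : Set Plane) (k : Iterate) (u v : Plane → Vec) : ℝ :=
  aElastic p Ω k u v
  - p.ε₀ * p.εa * ip Ω (fun x ↦ u x ⬝ᵥ wgrad Ω k.φ x) (fun x ↦ v x ⬝ᵥ wgrad Ω k.φ x)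
  + p.es * (ip Ω (wdiv Ω u) (fun x ↦ v x ⬝ᵥ wgrad Ω k.φ x)
    + ip Ω (wdiv Ω v) (fun x ↦ u x ⬝ᵥ wgrad Ω k.φ x))
  + p.eb * (ipv Ω (fun x ↦ u x ⨯₃ wcurl Ω v x) (wgrad Ω k.φ)
    + ipv Ω (fun x ↦ v x ⨯₃ wcurl Ω u x) (wgrad Ω k.φ))

/-- The mixed second derivative of the flexoelectric Lagrangian in `n` (direction `v`) and `φ`
(direction `ψ`). -/
def mixedForm (p : Material) (Ω : Set Plane) (k : Iterate) (v : Plane → Vec) (ψ : Plane → ℝ) : ℝ :=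
  - p.ε₀ * p.εa * ip Ω (fun x ↦ k.n x ⬝ᵥ wgrad Ω k.φ x) (fun x ↦ v x ⬝ᵥ wgrad Ω ψ x)
  - p.ε₀ * p.εa * ip Ω (fun x ↦ v x ⬝ᵥ wgrad Ω k.φ x) (fun x ↦ k.n x ⬝ᵥ wgrad Ω ψ x)
  + p.es * (ip Ω (wdiv Ω v) (fun x ↦ k.n x ⬝ᵥ wgrad Ω ψ x)
    + ip Ω (wdiv Ω k.n) (fun x ↦ v x ⬝ᵥ wgrad Ω ψ x))
  + p.eb * (ipv Ω (fun x ↦ k.n x ⨯₃ wcurl Ω v x) (wgrad Ω ψ)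
    + ipv Ω (fun x ↦ v x ⨯₃ wcurl Ω k.n x) (wgrad Ω ψ))

/-- The form `b(v, γ)`: mixed second derivative in `n` and `λ`. -/
def bForm (Ω : Set Plane) (k : Iterate) (v : Plane → Vec) (γ : Plane → ℝ) : ℝ :=
  ∫ x in Ω, γ x * (k.n x ⬝ᵥ v x)

/-- The form `c(χ, ψ)`: minus the second derivative with respect to `φ`. -/
def cForm (p : Material) (Ω : Set Plane) (k : Iterate) (χ ψ : Plane → ℝ) : ℝ :=
  p.ε₀ * p.εperp * ipv Ω (wgrad Ω χ) (wgrad Ω ψ)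
  + p.ε₀ * p.εa * ip Ω (fun x ↦ k.n x ⬝ᵥ wgrad Ω χ x) (fun x ↦ k.n x ⬝ᵥ wgrad Ω ψ x)

/-! ### Quadrilateral subdivisions -/

/-- The closed reference square `[0,1]²`. -/
def refSquare : Set Plane := {s | ∀ i, s i ∈ Set.Icc (0 : ℝ) 1}

/-- The open reference square `(0,1)²`. -/
def refSquareOpen : Set Plane := {s | ∀ i, s i ∈ Set.Ioo (0 : ℝ) 1}

/-- The bilinear map from the reference square onto the quadrilateral with consecutive vertices
`P 0, P 1, P 2, P 3`. -/
def quadMap (P : Fin 4 → Plane) (s : Plane) : Plane :=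
  ((1 - s 0) * (1 - s 1)) • P 0 + (s 0 * (1 - s 1)) • P 1 + (s 0 * s 1) • P 2
    + ((1 - s 0) * s 1) • P 3

/-- The four points are the consecutive vertices of a nondegenerate convex quadrilateral: the
bilinear reference map is injective with invertible derivative on the closed reference square. -/
def IsQuad (P : Fin 4 → Plane) : Prop :=
  Set.InjOn (quadMap P) refSquare ∧ ∀ s ∈ refSquare, (fderiv ℝ (quadMap P) s).det ≠ 0

/-- The closed quadrilateral. -/
def cell (P : Fin 4 → Plane) : Set Plane := quadMap P '' refSquare

/-- The open quadrilateral. -/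
def openCell (P : Fin 4 → Plane) : Set Plane := quadMap P '' refSquareOpen

/-- The quadrilaterals with vertices `P T`, `T : τ`, form a subdivision of `Ω`: the open cells lie
in `Ω` and are pairwise disjoint, and the closed cells cover exactly the closure of `Ω`. (Hanging
nodes are not excluded.) -/
structure IsQuadMesh {τ : Type*} (Ω : Set Plane) (P : τ → Fin 4 → Plane) : Prop where
  isQuad : ∀ T, IsQuad (P T)
  open_subset : ∀ T, openCell (P T) ⊆ Ω
  disjoint : ∀ T T', T ≠ T' → Disjoint (openCell (P T)) (openCell (P T'))
  cover : ⋃ T, cell (P T) = closure Ω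

/-! ### Finite element spaces -/

/-- The tensor-product polynomial of degree at most `m` in each variable with coefficients `c`. -/
def qPoly (m : ℕ) (c : Fin (m + 1) → Fin (m + 1) → ℝ) (s : Plane) : ℝ :=
  ∑ i, ∑ j, c i j * s 0 ^ (i : ℕ) * s 1 ^ (j : ℕ)

/-- The scalar space `Q_m`: continuous functions on the closure of `Ω` that are (mapped)
tensor-product polynomials of degree `m` on each cell. -/
def IsQm {τ : Type*} (Ω : Set Plane) (P : τ → Fin 4 → Plane) (m : ℕ) (q : Plane → ℝ) : Prop :=
  ContinuousOn q (closure Ω) ∧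
    ∀ T, ∃ c, ∀ s ∈ refSquare, q (quadMap (P T) s) = qPoly m c s

/-- The biquadratic bubble on the reference square; it vanishes on the boundary of the square. -/
def refBubble (s : Plane) : ℝ := 16 * (s 0 * (1 - s 0)) * (s 1 * (1 - s 1))

/-- The bubble space: continuous fields on the closure of `Ω`, zero on the boundary of `Ω`, that
are equal to `a_T b_T n_k` on each cell `T`, with constants `a_T`. -/
def IsBubble {τ : Type*} (Ω : Set Plane) (P : τ → Fin 4 → Plane) (n : Plane → Vec)
    (w : Plane → Vec) : Prop :=
  ContinuousOn w (closure Ω) ∧ (∀ x ∈ frontier Ω, w x = 0) ∧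
    ∀ T, ∃ a : ℝ, ∀ s ∈ refSquare,
      w (quadMap (P T) s) = (a * refBubble s) • n (quadMap (P T) s)

/-- The director space `V_h`: sums of an element of `Q_m × Q_m × Q_m` and of a bubble field, that
vanish on the boundary of `Ω`. Elements are extended by zero outside `Ω`, so that distinct elements
of this subspace are distinct on `Ω`. -/
def Vh {τ : Type*} (Ω : Set Plane) (P : τ → Fin 4 → Plane) (m : ℕ) (n : Plane → Vec) :
    Submodule ℝ (Plane → Vec) where
  carrier := {v | (∀ x ∉ Ω, v x = 0) ∧ ∃ q w : Plane → Vec,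
    (∀ i, IsQm Ω P m (fun x ↦ q x i)) ∧ IsBubble Ω P n w ∧ ∀ x ∈ closure Ω, v x = q x + w x}
  zero_mem' := by
    refine ⟨fun x _ ↦ rfl, 0, 0, fun i ↦ ⟨continuousOn_const, fun T ↦ ⟨0, fun s _ ↦ ?_⟩⟩,
      ⟨continuousOn_const, fun x _ ↦ rfl, fun T ↦ ⟨0, fun s _ ↦ ?_⟩⟩, fun x _ ↦ ?_⟩ <;>
      simp [qPoly]
  add_mem' := by
    rintro v v' ⟨h0, q, w, hq, ⟨hw, hw0, hwT⟩, hv⟩ ⟨h0', q', w', hq', ⟨hw', hw0', hwT'⟩, hv'⟩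
    refine ⟨fun x hx ↦ by simp [h0 x hx, h0' x hx], q + q', w + w', fun i ↦ ⟨?_, fun T ↦ ?_⟩,
      ⟨hw.add hw', fun x hx ↦ by simp [hw0 x hx, hw0' x hx], fun T ↦ ?_⟩, fun x hx ↦ ?_⟩
    · exact (hq i).1.add (hq' i).1
    · obtain ⟨c, hc⟩ := (hq i).2 T
      obtain ⟨c', hc'⟩ := (hq' i).2 T
      refine ⟨c + c', fun s hs ↦ ?_⟩
      have h1 := hc s hs
      have h2 := hc' s hs
      simp only [Pi.add_apply, h1, h2, qPoly, add_mul, Finset.sum_add_distrib]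
    · obtain ⟨a, ha⟩ := hwT T
      obtain ⟨a', ha'⟩ := hwT' T
      refine ⟨a + a', fun s hs ↦ ?_⟩
      simp only [Pi.add_apply, ha s hs, ha' s hs, add_mul, add_smul]
    · simp only [Pi.add_apply, hv x hx, hv' x hx]
      abel
  smul_mem' := by
    rintro r v ⟨h0, q, w, hq, ⟨hw, hw0, hwT⟩, hv⟩
    refine ⟨fun x hx ↦ by simp [h0 x hx], r • q, r • w, fun i ↦ ⟨?_, fun T ↦ ?_⟩,
      ⟨hw.const_smul r, fun x hx ↦ by simp [hw0 x hx], fun T ↦ ?_⟩, fun x hx ↦ ?_⟩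
    · exact (hq i).1.const_smul r
    · obtain ⟨c, hc⟩ := (hq i).2 T
      refine ⟨r • c, fun s hs ↦ ?_⟩
      have h1 := hc s hs
      simp only [Pi.smul_apply, smul_eq_mul, h1, qPoly, Finset.mul_sum, mul_assoc]
    · obtain ⟨a, ha⟩ := hwT T
      refine ⟨r * a, fun s hs ↦ ?_⟩
      simp only [Pi.smul_apply, ha s hs, smul_smul, mul_assoc]
    · simp only [Pi.smul_apply, hv x hx, smul_add]

/-- The multiplier space `P_0`: functions in `L²(Ω)` that are constant on each cell. -/
def P0 {τ : Type*} (Ω : Set Plane) (P : τ → Fin 4 → Plane) :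
    Submodule ℝ (Lp ℝ 2 (volume.restrict Ω)) where
  carrier := {γ | ∀ T, ∃ r : ℝ, ∀ᵐ x ∂(volume.restrict Ω), x ∈ openCell (P T) → γ x = r}
  zero_mem' := fun T ↦ ⟨0, by
    filter_upwards [Lp.coeFn_zero ℝ 2 (volume.restrict Ω)] with x hx _ using hx⟩
  add_mem' := by
    intro γ γ' h h' T
    obtain ⟨r, hr⟩ := h T
    obtain ⟨r', hr'⟩ := h' T
    refine ⟨r + r', ?_⟩
    filter_upwards [hr, hr', Lp.coeFn_add γ γ'] with x h1 h2 h3 hx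
    rw [h3, Pi.add_apply, h1 hx, h2 hx]
  smul_mem' := by
    intro t γ h T
    obtain ⟨r, hr⟩ := h T
    refine ⟨t * r, ?_⟩
    filter_upwards [hr, Lp.coeFn_smul t γ] with x h1 h2 hx
    rw [h2, Pi.smul_apply, h1 hx, smul_eq_mul]

/-! ### The discretized Newton Hessian -/

/-- The matrix of the discretized flexoelectric Newton linearization with blocks
`[A, B₁, B₂; B₁ᵀ, -C, 0; B₂ᵀ, 0, 0]`, for given basis functions `v i` of the director space, `ψ i` of
the potential space and `γ i` of the multiplier space. -/
def Mbar {ι₁ ι₂ ι₃ : Type*} (p : Material) (Ω : Set Plane) (k : Iterate)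
    (v : ι₁ → Plane → Vec) (ψ : ι₂ → Plane → ℝ) (γ : ι₃ → Plane → ℝ) :
    Matrix (ι₁ ⊕ (ι₂ ⊕ ι₃)) (ι₁ ⊕ (ι₂ ⊕ ι₃)) ℝ :=
  let A : Matrix ι₁ ι₁ ℝ := Matrix.of fun i j ↦ aForm p Ω k (v j) (v i)
  let B₁ : Matrix ι₁ ι₂ ℝ := Matrix.of fun i j ↦ mixedForm p Ω k (v i) (ψ j)
  let B₂ : Matrix ι₁ ι₃ ℝ := Matrix.of fun i j ↦ bForm Ω k (v i) (γ j)
  let C : Matrix ι₂ ι₂ ℝ := Matrix.of fun i j ↦ cForm p Ω k (ψ j) (ψ i)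
  Matrix.fromBlocks A (Matrix.fromCols B₁ B₂) (Matrix.fromRows B₁ᵀ B₂ᵀ)
    (Matrix.fromBlocks (-C) 0 0 0)

end Flexo

end

/-!
Invertibility of the discretized Newton Hessian.

A kernel vector of the matrix consists of the coordinates of a director field `v`, a potential `ψ`
and a multiplier `γ`. Pairing the kernel equations with `(v, -ψ, -γ)` cancels the coupling forms `d`
and `b` and leaves `a(v, v) + c(ψ, ψ) = 0` (`isUnit_saddle`). Both forms are definite. The
free elastic form is coercive by assumption, and Young's inequality bounds the electric and
flexoelectric terms by a smaller multiple of the same norm (`aForm_self_ge`). The pointwise bound on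
the director makes `c` coercive for the gradient seminorm (`exists_cForm_self_ge`), which is
definite on `H¹₀(Ω)` (`IsH10.ae_eq_zero`). Hence `v = 0` and `ψ = 0`, so that `b(·, γ)` vanishes
on the director space, and testing with the bubble field of one cell shows that `γ` vanishes on that
cell (`eq_zero_of_bForm_eq_zero`).

The matrix represents bilinear forms only if the weak divergence and curl act linearly on the
director space; as `wdiv` and `wcurl` have junk values outside `H(div)` and `H(curl)`, this
requires the conformity of the space (`isHDC_of_mem_Vh`), the analytic core of the proof:

* A continuous function that is Lipschitz on each of finitely many closed pieces is Lipschitz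
  (`lipschitzWith_of_closed_cover`), and the inverse of a bilinear reference map is Lipschitz
  (`IsQuad.exists_dist_le`). So `Q_m` functions and bubbles, extended by zero, are Lipschitz on the
  plane, and on `Ω` a director field is a sum of Lipschitz multiples of constant fields and of `n_k`.
* Weak derivatives may be tested with compactly supported Lipschitz functions
  (`exists_isTest_tendsto`), which yields the product rule for a Lipschitz multiple of a
  field in `H(div) ∩ H(curl)` (`IsHDC.lipschitz_smul`). Neither `n_k` nor the bubble is
  differentiable enough for a classical product rule.
-/

noncomputable section

namespace Flexo

open scoped NNReal Convolution

/-! ### Products of fields in Lebesgue spaces -/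

lemma memLp_mul {μ : Measure Plane} {p q r : ℝ≥0∞} [p.HolderTriple q r] {f g : Plane → ℝ}
    (hf : MemLp f p μ) (hg : MemLp g q μ) : MemLp (fun x ↦ f x * g x) r μ :=
  MemLp.mul (p := p) (q := q) hg hf

lemma memLp_dot {μ : Measure Plane} {p q r : ℝ≥0∞} [p.HolderTriple q r] {f g : Plane → Vec}
    (hf : MemLp f p μ) (hg : MemLp g q μ) : MemLp (fun x ↦ f x ⬝ᵥ g x) r μ := by
  simp only [dotProduct]
  exact memLp_finsetSum _ fun i _ ↦ memLp_mul (p := p) (q := q) (hf.eval i) (hg.eval i)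

lemma memLp_cross {μ : Measure Plane} {p q r : ℝ≥0∞} [p.HolderTriple q r] {f g : Plane → Vec}
    (hf : MemLp f p μ) (hg : MemLp g q μ) : MemLp (fun x ↦ f x ⨯₃ g x) r μ := by
  refine MemLp.of_eval fun i ↦ ?_
  fin_cases i <;> simp only [cross_apply] <;>
    exact (memLp_mul (p := p) (q := q) (hf.eval _) (hg.eval _)).sub
      (memLp_mul (p := p) (q := q) (hf.eval _) (hg.eval _))

lemma integrable_mul_of_memLp {μ : Measure Plane} {f g : Plane → ℝ}
    (hf : MemLp f 2 μ) (hg : MemLp g 2 μ) : Integrable (fun x ↦ f x * g x) μ :=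
  memLp_one_iff_integrable.1 (memLp_mul hf hg)

lemma integrable_dot_of_memLp {μ : Measure Plane} {f g : Plane → Vec}
    (hf : MemLp f 2 μ) (hg : MemLp g 2 μ) : Integrable (fun x ↦ f x ⬝ᵥ g x) μ :=
  memLp_one_iff_integrable.1 (memLp_dot hf hg)

/-! ### Test functions -/

lemma IsTest.continuous_pd {Ω : Set Plane} {η : Plane → ℝ} (h : IsTest Ω η) (i : Fin 2) :
    Continuous (pd i η) :=
  (h.1.continuous_fderiv (by simp)).clm_apply continuous_const

lemma IsTest.hasCompactSupport_pd {Ω : Set Plane} {η : Plane → ℝ} (h : IsTest Ω η) (i : Fin 2) :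
    HasCompactSupport (pd i η) :=
  h.2.1.fderiv_apply (𝕜 := ℝ) _

lemma IsTest.memLp {Ω : Set Plane} {η : Plane → ℝ} (h : IsTest Ω η) (p : ℝ≥0∞) :
    MemLp η p (volume.restrict Ω) :=
  h.1.continuous.memLp_of_hasCompactSupport h.2.1

lemma IsTest.memLp_pd {Ω : Set Plane} {η : Plane → ℝ} (h : IsTest Ω η) (i : Fin 2) (p : ℝ≥0∞) :
    MemLp (pd i η) p (volume.restrict Ω) :=
  (h.continuous_pd i).memLp_of_hasCompactSupport (h.hasCompactSupport_pd i)

lemma IsTest.memLp_cgrad {Ω : Set Plane} {η : Plane → ℝ} (h : IsTest Ω η) (p : ℝ≥0∞) :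
    MemLp (cgrad η) p (volume.restrict Ω) := by
  refine MemLp.of_eval fun i ↦ ?_
  fin_cases i
  · exact h.memLp_pd 0 p
  · exact h.memLp_pd 1 p
  · exact MemLp.zero

lemma IsTestField.memLp {Ω : Set Plane} {w : Plane → Vec} (h : IsTestField Ω w) (p : ℝ≥0∞) :
    MemLp w p (volume.restrict Ω) :=
  MemLp.of_eval fun i ↦ (h i).memLp p

lemma IsTestField.memLp_cdiv {Ω : Set Plane} {w : Plane → Vec} (h : IsTestField Ω w) (p : ℝ≥0∞) :
    MemLp (cdiv w) p (volume.restrict Ω) :=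
  ((h 0).memLp_pd 0 p).add ((h 1).memLp_pd 1 p)

lemma IsTestField.memLp_ccurl {Ω : Set Plane} {w : Plane → Vec} (h : IsTestField Ω w) (p : ℝ≥0∞) :
    MemLp (ccurl w) p (volume.restrict Ω) := by
  refine MemLp.of_eval fun i ↦ ?_
  fin_cases i
  · exact (h 2).memLp_pd 1 p
  · exact ((h 2).memLp_pd 0 p).neg
  · exact ((h 1).memLp_pd 0 p).sub ((h 0).memLp_pd 1 p)

lemma isTest_zero (Ω : Set Plane) : IsTest Ω (fun _ ↦ 0) := by
  refine ⟨contDiff_const, HasCompactSupport.zero, ?_⟩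
  have : tsupport (fun _ : Plane ↦ (0 : ℝ)) = ∅ := by
    rw [tsupport_eq_empty_iff]; rfl
  rw [this]
  exact Set.empty_subset _

/-- A scalar test function placed in one component is a test field. -/
lemma IsTest.single {Ω : Set Plane} {η : Plane → ℝ} (h : IsTest Ω η) (i : Fin 3) :
    IsTestField Ω (fun x ↦ Pi.single i (η x)) := by
  intro j
  by_cases hij : j = i
  · subst hij
    simpa using h
  · simpa [hij] using isTest_zero Ω

/-- The fundamental lemma of the calculus of variations in `L²(Ω)`. -/
lemma ae_eq_of_forall_test {Ω : Set Plane} (hΩ : IsOpen Ω) {f g : Plane → ℝ}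
    (hf : MemLp f 2 (volume.restrict Ω)) (hg : MemLp g 2 (volume.restrict Ω))
    (h : ∀ η, IsTest Ω η → ∫ x in Ω, f x * η x = ∫ x in Ω, g x * η x) :
    f =ᵐ[volume.restrict Ω] g := by
  have hloc : LocallyIntegrableOn (fun x ↦ f x - g x) Ω volume := by
    refine (locallyIntegrableOn_iff hΩ.isLocallyClosed).2 fun K hK hKc ↦ ?_
    have h2 : MemLp (fun x ↦ f x - g x) 2 (volume.restrict K) :=
      (hf.sub hg).mono_measure (Measure.restrict_mono hK le_rfl)
    have : IsFiniteMeasure (volume.restrict K) := ⟨by simpa using hKc.measure_lt_top⟩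
    exact h2.integrable (by norm_num)
  have := hΩ.ae_eq_zero_of_integral_contDiff_smul_eq_zero hloc ?_
  · rw [Filter.EventuallyEq, ae_restrict_iff' hΩ.measurableSet]
    filter_upwards [this] with x hx hxΩ
    linarith [hx hxΩ]
  · intro η h1 h2 h3
    have hη : IsTest Ω η := ⟨h1, h2, h3⟩
    rw [← setIntegral_eq_integral_of_forall_compl_eq_zero (s := Ω)]
    · have e : ∀ x, η x • (f x - g x) = f x * η x - g x * η x := fun x ↦ by
        rw [smul_eq_mul]; ring
      simp only [e]
      rw [integral_sub (integrable_mul_of_memLp hf (hη.memLp 2))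
        (integrable_mul_of_memLp hg (hη.memLp 2)), h η hη, sub_self]
    · intro x hx
      rw [image_eq_zero_of_notMem_tsupport (fun hx' ↦ hx (h3 hx')), zero_smul]

lemma ae_eq_of_forall_testField {Ω : Set Plane} (hΩ : IsOpen Ω) {f g : Plane → Vec}
    (hf : MemLp f 2 (volume.restrict Ω)) (hg : MemLp g 2 (volume.restrict Ω))
    (h : ∀ w, IsTestField Ω w → ∫ x in Ω, f x ⬝ᵥ w x = ∫ x in Ω, g x ⬝ᵥ w x) :
    f =ᵐ[volume.restrict Ω] g := by
  have : ∀ i, (fun x ↦ f x i) =ᵐ[volume.restrict Ω] fun x ↦ g x i := fun i ↦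
    ae_eq_of_forall_test hΩ (hf.eval i) (hg.eval i) fun η hη ↦ by
      simpa using h _ (hη.single i)
  filter_upwards [ae_all_iff.2 this] with x hx
  exact funext hx

/-! ### Weak derivatives: uniqueness and linearity -/

section Weak

variable {Ω : Set Plane}

lemma IsWeakGrad.unique (hΩ : IsOpen Ω) {f : Plane → ℝ} {g g' : Plane → Vec}
    (h : IsWeakGrad Ω f g) (h' : IsWeakGrad Ω f g') : g =ᵐ[volume.restrict Ω] g' :=
  ae_eq_of_forall_testField hΩ h.1 h'.1 fun w hw ↦ by
    linarith [h.2 w hw, h'.2 w hw]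

lemma IsWeakDiv.unique (hΩ : IsOpen Ω) {v : Plane → Vec} {d d' : Plane → ℝ}
    (h : IsWeakDiv Ω v d) (h' : IsWeakDiv Ω v d') : d =ᵐ[volume.restrict Ω] d' :=
  ae_eq_of_forall_test hΩ h.1 h'.1 fun w hw ↦ by
    linarith [h.2 w hw, h'.2 w hw]

lemma IsWeakCurl.unique (hΩ : IsOpen Ω) {v c c' : Plane → Vec}
    (h : IsWeakCurl Ω v c) (h' : IsWeakCurl Ω v c') : c =ᵐ[volume.restrict Ω] c' :=
  ae_eq_of_forall_testField hΩ h.1 h'.1 fun w hw ↦ by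
    linarith [h.2 w hw, h'.2 w hw]

lemma IsWeakGrad.add {f f' : Plane → ℝ} {g g' : Plane → Vec}
    (hf : MemLp f 2 (volume.restrict Ω)) (hf' : MemLp f' 2 (volume.restrict Ω))
    (h : IsWeakGrad Ω f g) (h' : IsWeakGrad Ω f' g') :
    IsWeakGrad Ω (fun x ↦ f x + f' x) (fun x ↦ g x + g' x) := by
  refine ⟨h.1.add h'.1, fun w hw ↦ ?_⟩
  simp only [add_mul, add_dotProduct]
  rw [integral_add (integrable_mul_of_memLp hf (hw.memLp_cdiv 2))
      (integrable_mul_of_memLp hf' (hw.memLp_cdiv 2)),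
    integral_add (integrable_dot_of_memLp h.1 (hw.memLp 2))
      (integrable_dot_of_memLp h'.1 (hw.memLp 2)), h.2 w hw, h'.2 w hw]
  ring

lemma IsWeakGrad.smul {f : Plane → ℝ} {g : Plane → Vec} (h : IsWeakGrad Ω f g) (r : ℝ) :
    IsWeakGrad Ω (fun x ↦ r * f x) (fun x ↦ r • g x) := by
  refine ⟨h.1.const_smul r, fun w hw ↦ ?_⟩
  simp only [mul_assoc, smul_dotProduct, smul_eq_mul]
  rw [integral_const_mul, integral_const_mul, h.2 w hw]
  ring

lemma IsWeakGrad.congr {f f' : Plane → ℝ} {g : Plane → Vec} (h : IsWeakGrad Ω f g)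
    (hff' : f =ᵐ[volume.restrict Ω] f') : IsWeakGrad Ω f' g := by
  refine ⟨h.1, fun w hw ↦ ?_⟩
  rw [← h.2 w hw]
  refine integral_congr_ae ?_
  filter_upwards [hff'] with x hx
  rw [hx]

lemma IsWeakDiv.add {v v' : Plane → Vec} {d d' : Plane → ℝ}
    (hv : MemLp v 2 (volume.restrict Ω)) (hv' : MemLp v' 2 (volume.restrict Ω))
    (h : IsWeakDiv Ω v d) (h' : IsWeakDiv Ω v' d') :
    IsWeakDiv Ω (fun x ↦ v x + v' x) (fun x ↦ d x + d' x) := by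
  refine ⟨h.1.add h'.1, fun w hw ↦ ?_⟩
  simp only [add_mul, add_dotProduct]
  rw [integral_add (integrable_dot_of_memLp hv (hw.memLp_cgrad 2))
      (integrable_dot_of_memLp hv' (hw.memLp_cgrad 2)),
    integral_add (integrable_mul_of_memLp h.1 (hw.memLp 2))
      (integrable_mul_of_memLp h'.1 (hw.memLp 2)), h.2 w hw, h'.2 w hw]
  ring

lemma IsWeakDiv.smul {v : Plane → Vec} {d : Plane → ℝ} (h : IsWeakDiv Ω v d) (r : ℝ) :
    IsWeakDiv Ω (fun x ↦ r • v x) (fun x ↦ r * d x) := by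
  refine ⟨h.1.const_smul r, fun w hw ↦ ?_⟩
  simp only [mul_assoc, smul_dotProduct, smul_eq_mul]
  rw [integral_const_mul, integral_const_mul, h.2 w hw]
  ring

lemma IsWeakDiv.congr {v v' : Plane → Vec} {d : Plane → ℝ} (h : IsWeakDiv Ω v d)
    (hvv' : v =ᵐ[volume.restrict Ω] v') : IsWeakDiv Ω v' d := by
  refine ⟨h.1, fun w hw ↦ ?_⟩
  rw [← h.2 w hw]
  refine integral_congr_ae ?_
  filter_upwards [hvv'] with x hx
  rw [hx]

lemma IsWeakCurl.add {v v' c c' : Plane → Vec}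
    (hv : MemLp v 2 (volume.restrict Ω)) (hv' : MemLp v' 2 (volume.restrict Ω))
    (h : IsWeakCurl Ω v c) (h' : IsWeakCurl Ω v' c') :
    IsWeakCurl Ω (fun x ↦ v x + v' x) (fun x ↦ c x + c' x) := by
  refine ⟨h.1.add h'.1, fun w hw ↦ ?_⟩
  simp only [add_dotProduct]
  rw [integral_add (integrable_dot_of_memLp hv (hw.memLp_ccurl 2))
      (integrable_dot_of_memLp hv' (hw.memLp_ccurl 2)),
    integral_add (integrable_dot_of_memLp h.1 (hw.memLp 2))
      (integrable_dot_of_memLp h'.1 (hw.memLp 2)), h.2 w hw, h'.2 w hw]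

lemma IsWeakCurl.smul {v c : Plane → Vec} (h : IsWeakCurl Ω v c) (r : ℝ) :
    IsWeakCurl Ω (fun x ↦ r • v x) (fun x ↦ r • c x) := by
  refine ⟨h.1.const_smul r, fun w hw ↦ ?_⟩
  simp only [smul_dotProduct, smul_eq_mul]
  rw [integral_const_mul, integral_const_mul, h.2 w hw]

lemma IsWeakCurl.congr {v v' c : Plane → Vec} (h : IsWeakCurl Ω v c)
    (hvv' : v =ᵐ[volume.restrict Ω] v') : IsWeakCurl Ω v' c := by
  refine ⟨h.1, fun w hw ↦ ?_⟩
  rw [← h.2 w hw]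
  refine integral_congr_ae ?_
  filter_upwards [hvv'] with x hx
  rw [hx]

lemma isWeakGrad_wgrad {f : Plane → ℝ} (h : ∃ g, IsWeakGrad Ω f g) :
    IsWeakGrad Ω f (wgrad Ω f) := by
  rw [wgrad, dif_pos h]
  exact h.choose_spec

lemma isWeakDiv_wdiv {v : Plane → Vec} (h : ∃ d, IsWeakDiv Ω v d) :
    IsWeakDiv Ω v (wdiv Ω v) := by
  rw [wdiv, dif_pos h]
  exact h.choose_spec

lemma isWeakCurl_wcurl {v : Plane → Vec} (h : ∃ c, IsWeakCurl Ω v c) :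
    IsWeakCurl Ω v (wcurl Ω v) := by
  rw [wcurl, dif_pos h]
  exact h.choose_spec

lemma IsHDC.memLp_wdiv {v : Plane → Vec} (h : IsHDC Ω v) :
    MemLp (wdiv Ω v) 2 (volume.restrict Ω) := (isWeakDiv_wdiv h.2.1).1

lemma IsHDC.memLp_wcurl {v : Plane → Vec} (h : IsHDC Ω v) :
    MemLp (wcurl Ω v) 2 (volume.restrict Ω) := (isWeakCurl_wcurl h.2.2).1

lemma IsH1.memLp_wgrad {f : Plane → ℝ} (h : IsH1 Ω f) :
    MemLp (wgrad Ω f) 2 (volume.restrict Ω) := (isWeakGrad_wgrad h.2).1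

lemma wdiv_add (hΩ : IsOpen Ω) {v v' : Plane → Vec} (h : IsHDC Ω v) (h' : IsHDC Ω v') :
    wdiv Ω (v + v') =ᵐ[volume.restrict Ω] fun x ↦ wdiv Ω v x + wdiv Ω v' x :=
  have := (isWeakDiv_wdiv h.2.1).add h.1 h'.1 (isWeakDiv_wdiv h'.2.1)
  (isWeakDiv_wdiv ⟨_, this⟩).unique hΩ this

lemma wdiv_smul (hΩ : IsOpen Ω) {v : Plane → Vec} (h : IsHDC Ω v) (r : ℝ) :
    wdiv Ω (r • v) =ᵐ[volume.restrict Ω] fun x ↦ r * wdiv Ω v x :=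
  have := (isWeakDiv_wdiv h.2.1).smul r
  (isWeakDiv_wdiv ⟨_, this⟩).unique hΩ this

lemma wcurl_add (hΩ : IsOpen Ω) {v v' : Plane → Vec} (h : IsHDC Ω v) (h' : IsHDC Ω v') :
    wcurl Ω (v + v') =ᵐ[volume.restrict Ω] fun x ↦ wcurl Ω v x + wcurl Ω v' x :=
  have := (isWeakCurl_wcurl h.2.2).add h.1 h'.1 (isWeakCurl_wcurl h'.2.2)
  (isWeakCurl_wcurl ⟨_, this⟩).unique hΩ this

lemma wcurl_smul (hΩ : IsOpen Ω) {v : Plane → Vec} (h : IsHDC Ω v) (r : ℝ) :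
    wcurl Ω (r • v) =ᵐ[volume.restrict Ω] fun x ↦ r • wcurl Ω v x :=
  have := (isWeakCurl_wcurl h.2.2).smul r
  (isWeakCurl_wcurl ⟨_, this⟩).unique hΩ this

lemma wgrad_coe_add (hΩ : IsOpen Ω) {f f' : Lp ℝ 2 (volume.restrict Ω)} (h : IsH1 Ω f)
    (h' : IsH1 Ω f') :
    wgrad Ω (f + f' : Lp ℝ 2 (volume.restrict Ω)) =ᵐ[volume.restrict Ω]
      fun x ↦ wgrad Ω f x + wgrad Ω f' x :=
  have := ((isWeakGrad_wgrad h.2).add h.1 h'.1 (isWeakGrad_wgrad h'.2)).congr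
    (Lp.coeFn_add f f').symm
  (isWeakGrad_wgrad ⟨_, this⟩).unique hΩ this

lemma wgrad_coe_smul (hΩ : IsOpen Ω) {f : Lp ℝ 2 (volume.restrict Ω)} (h : IsH1 Ω f) (r : ℝ) :
    wgrad Ω (r • f : Lp ℝ 2 (volume.restrict Ω)) =ᵐ[volume.restrict Ω]
      fun x ↦ r • wgrad Ω f x :=
  have := ((isWeakGrad_wgrad h.2).smul r).congr (Lp.coeFn_smul r f).symm
  (isWeakGrad_wgrad ⟨_, this⟩).unique hΩ this

lemma IsHDC.add {v v' : Plane → Vec} (h : IsHDC Ω v) (h' : IsHDC Ω v') :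
    IsHDC Ω (fun x ↦ v x + v' x) :=
  ⟨h.1.add h'.1, ⟨_, (isWeakDiv_wdiv h.2.1).add h.1 h'.1 (isWeakDiv_wdiv h'.2.1)⟩,
    ⟨_, (isWeakCurl_wcurl h.2.2).add h.1 h'.1 (isWeakCurl_wcurl h'.2.2)⟩⟩

lemma IsHDC.congr {v v' : Plane → Vec} (h : IsHDC Ω v) (hvv' : v =ᵐ[volume.restrict Ω] v') :
    IsHDC Ω v' :=
  ⟨(memLp_congr_ae hvv').1 h.1, ⟨_, (isWeakDiv_wdiv h.2.1).congr hvv'⟩,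
    ⟨_, (isWeakCurl_wcurl h.2.2).congr hvv'⟩⟩

end Weak

/-! ### Piecewise Lipschitz functions -/

/-- A function on the plane that is Lipschitz on each piece of a finite closed cover is Lipschitz:
along a segment, the right difference quotients are bounded, because by pigeonhole and closedness
some piece containing the base point also contains points arbitrarily close to the right of it. -/
lemma lipschitzWith_of_closed_cover {ι : Type*} [Finite ι] {f : Plane → ℝ} {S : ι → Set Plane}
    (hS : ∀ i, IsClosed (S i)) (hcov : ⋃ i, S i = Set.univ) {K : ℝ≥0}
    (hf : ∀ i, LipschitzOnWith K f (S i)) : LipschitzWith K f := by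
  have hcont : Continuous f :=
    (locallyFinite_of_finite S).continuous hcov hS fun i ↦ (hf i).continuousOn
  refine LipschitzWith.of_le_add_mul K fun y x ↦ ?_
  set ℓ : ℝ → Plane := fun t ↦ AffineMap.lineMap x y t with hℓ
  have hℓc : Continuous ℓ := AffineMap.lineMap_continuous
  have hdist : ∀ s t, dist (ℓ s) (ℓ t) = dist s t * dist x y := fun s t ↦
    dist_lineMap_lineMap x y s t
  have key := image_le_of_liminf_slope_right_le_deriv_boundary (f := fun t ↦ f (ℓ t)) (a := 0)
    (b := 1) (B := fun t ↦ f x + K * dist x y * t) (B' := fun _ ↦ K * dist x y)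
    (hcont.comp hℓc).continuousOn (by simp [hℓ]) (by fun_prop)
    (fun t _ ↦ by
      simpa using (((hasDerivAt_id t).const_mul ((K : ℝ) * dist x y)).const_add
        (f x)).hasDerivWithinAt) ?_ (x := 1) (by simp)
  · simpa [hℓ, dist_comm x y] using key
  · intro t _ r hr
    obtain ⟨i, hi⟩ : ∃ i, ∃ᶠ z in 𝓝[>] t, ℓ z ∈ S i := by
      by_contra! hcon
      have h1 : ∀ᶠ z in 𝓝[>] t, ∀ i, ℓ z ∉ S i :=
        eventually_all.2 hcon
      obtain ⟨z, hz⟩ := h1.exists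
      have : ℓ z ∈ ⋃ i, S i := hcov ▸ Set.mem_univ _
      obtain ⟨i, hi⟩ := Set.mem_iUnion.1 this
      exact hz i hi
    have ht : ℓ t ∈ S i :=
      (hS i).mem_of_frequently_of_tendsto hi (hℓc.continuousAt.tendsto.mono_left inf_le_left)
    refine (hi.and_eventually self_mem_nhdsWithin).mono fun z ⟨hz, hzt⟩ ↦ ?_
    have hzt' : 0 < z - t := sub_pos.2 hzt
    refine lt_of_le_of_lt ?_ hr
    rw [slope_def_field, div_le_iff₀ hzt']
    have h1 := (hf i).dist_le_mul _ hz _ ht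
    rw [hdist, Real.dist_eq, Real.dist_eq, abs_of_pos hzt'] at h1
    calc f (ℓ z) - f (ℓ t) ≤ _ := le_abs_self _
      _ ≤ _ := h1
      _ = _ := by ring

lemma exists_lipschitzWith_of_closed_cover {ι : Type*} [Finite ι] {f : Plane → ℝ}
    {S : ι → Set Plane} (hS : ∀ i, IsClosed (S i)) (hcov : ⋃ i, S i = Set.univ)
    (hf : ∀ i, ∃ K, LipschitzOnWith K f (S i)) : ∃ K, LipschitzWith K f := by
  choose K hK using hf
  obtain ⟨M, hM⟩ := (Set.finite_range K).bddAbove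
  exact ⟨M, lipschitzWith_of_closed_cover hS hcov fun i ↦ (hK i).weaken (hM ⟨i, rfl⟩)⟩

/-! ### Geometry of the bilinear reference map -/

lemma refSquare_eq : refSquare =
    (EuclideanSpace.equiv (Fin 2) ℝ).toHomeomorph ⁻¹' Set.univ.pi fun _ ↦ Set.Icc 0 1 := by
  ext s
  simp only [refSquare, Set.mem_preimage, Set.mem_pi, Set.mem_univ, true_imp_iff]
  rfl

lemma refSquareOpen_eq : refSquareOpen =
    (EuclideanSpace.equiv (Fin 2) ℝ).toHomeomorph ⁻¹' Set.univ.pi fun _ ↦ Set.Ioo 0 1 := by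
  ext s
  simp only [refSquareOpen, Set.mem_preimage, Set.mem_pi, Set.mem_univ, true_imp_iff]
  rfl

lemma isCompact_refSquare : IsCompact refSquare := by
  rw [refSquare_eq, Homeomorph.isCompact_preimage]
  exact isCompact_univ_pi fun _ ↦ isCompact_Icc

lemma isOpen_refSquareOpen : IsOpen refSquareOpen := by
  rw [refSquareOpen_eq, Homeomorph.isOpen_preimage]
  exact isOpen_set_pi Set.finite_univ fun _ _ ↦ isOpen_Ioo

lemma closure_refSquareOpen : closure refSquareOpen = refSquare := by
  rw [refSquareOpen_eq, refSquare_eq, ← Homeomorph.preimage_closure, closure_pi_set]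
  simp [closure_Ioo (zero_ne_one (α := ℝ))]

lemma refSquareOpen_subset : refSquareOpen ⊆ refSquare :=
  fun _ hs i ↦ Set.Ioo_subset_Icc_self (hs i)

lemma convex_refSquare : Convex ℝ refSquare := by
  intro s hs t ht a b ha hb hab i
  simpa using (convex_Icc (0 : ℝ) 1) (hs i) (ht i) ha hb hab

lemma convex_refSquareOpen : Convex ℝ refSquareOpen := by
  intro s hs t ht a b ha hb hab i
  simpa using (convex_Ioo (0 : ℝ) 1) (hs i) (ht i) ha hb hab

lemma volume_refSquare_diff : volume (refSquare \ refSquareOpen) = 0 := by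
  have := convex_refSquareOpen.addHaar_frontier volume
  rwa [frontier, closure_refSquareOpen, isOpen_refSquareOpen.interior_eq] at this

lemma refSquareOpen_nonempty : refSquareOpen.Nonempty :=
  ⟨WithLp.toLp 2 fun _ ↦ 1 / 2, fun i ↦ by constructor <;> norm_num⟩

lemma contDiff_quadMap (P : Fin 4 → Plane) : ContDiff ℝ ∞ (quadMap P) := by
  unfold quadMap
  fun_prop

lemma contDiff_refBubble : ContDiff ℝ ∞ refBubble := by
  unfold refBubble
  fun_prop

lemma contDiff_qPoly (m : ℕ) (c : Fin (m + 1) → Fin (m + 1) → ℝ) : ContDiff ℝ ∞ (qPoly m c) := by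
  unfold qPoly
  fun_prop

lemma refBubble_pos {s : Plane} (hs : s ∈ refSquareOpen) : 0 < refBubble s := by
  have h0 := hs 0
  have h1 := hs 1
  have a0 : 0 < 1 - s 0 := sub_pos.2 h0.2
  have a1 : 0 < 1 - s 1 := sub_pos.2 h1.2
  have b0 := h0.1
  have b1 := h1.1
  unfold refBubble
  positivity

lemma refBubble_eq_zero {s : Plane} (hs : s ∈ refSquare) (hs' : s ∉ refSquareOpen) :
    refBubble s = 0 := by
  simp only [refSquareOpen, Set.mem_ofPred_eq, Fin.forall_fin_two, Set.mem_Ioo] at hs'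
  have h0 := hs 0
  have h1 := hs 1
  simp only [Set.mem_Icc] at h0 h1
  unfold refBubble
  rcases h0.1.eq_or_lt with h | h
  · rw [← h]; ring
  rcases h0.2.eq_or_lt with h' | h'
  · rw [h']; ring
  rcases h1.1.eq_or_lt with h'' | h''
  · rw [← h'']; ring
  rcases h1.2.eq_or_lt with h3 | h3
  · rw [h3]; ring
  exact absurd ⟨⟨h, h'⟩, h'', h3⟩ hs'

section Quad

variable {P : Fin 4 → Plane}

lemma isCompact_cell (P : Fin 4 → Plane) : IsCompact (cell P) :=
  isCompact_refSquare.image (contDiff_quadMap P).continuous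

lemma openCell_subset_cell (P : Fin 4 → Plane) : openCell P ⊆ cell P :=
  Set.image_mono refSquareOpen_subset

lemma cell_subset_closure_openCell (P : Fin 4 → Plane) : cell P ⊆ closure (openCell P) := by
  rw [cell, ← closure_refSquareOpen]
  exact image_closure_subset_closure_image (contDiff_quadMap P).continuous

lemma IsQuad.exists_equiv (hP : IsQuad P) {s : Plane} (hs : s ∈ refSquare) :
    ∃ e : Plane ≃L[ℝ] Plane, HasStrictFDerivAt (quadMap P) (e : Plane →L[ℝ] Plane) s := by
  refine ⟨ContinuousLinearMap.toContinuousLinearEquivOfDetNeZero _ (hP.2 s hs), ?_⟩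
  rw [ContinuousLinearMap.coe_toContinuousLinearEquivOfDetNeZero]
  exact (contDiff_quadMap P).contDiffAt.hasStrictFDerivAt (by simp)

lemma IsQuad.isOpen_openCell (hP : IsQuad P) : IsOpen (openCell P) := by
  refine isOpen_iff_mem_nhds.2 ?_
  rintro _ ⟨s, hs, rfl⟩
  obtain ⟨e, he⟩ := hP.exists_equiv (refSquareOpen_subset hs)
  rw [← he.map_nhds_eq_of_equiv]
  exact image_mem_map (isOpen_refSquareOpen.mem_nhds hs)

/-- The inverse of the reference map is Lipschitz: locally near the diagonal by invertibility of
the derivative, away from it by injectivity, and globally by compactness. -/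
lemma IsQuad.exists_dist_le (hP : IsQuad P) :
    ∃ K : ℝ≥0, ∀ s ∈ refSquare, ∀ t ∈ refSquare,
      dist s t ≤ K * dist (quadMap P s) (quadMap P t) := by
  have hc := (contDiff_quadMap P).continuous
  suffices h : ∃ K : ℝ≥0, ∀ z ∈ refSquare ×ˢ refSquare,
      dist z.1 z.2 ≤ K * dist (quadMap P z.1) (quadMap P z.2) by
    obtain ⟨K, hK⟩ := h
    exact ⟨K, fun s hs t ht ↦ hK (s, t) ⟨hs, ht⟩⟩
  refine (isCompact_refSquare.prod isCompact_refSquare).induction_on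
    (p := fun S ↦ ∃ K : ℝ≥0, ∀ z ∈ S, dist z.1 z.2 ≤ K * dist (quadMap P z.1) (quadMap P z.2))
    ⟨0, by simp⟩ (fun S T hST ⟨K, hK⟩ ↦ ⟨K, fun z hz ↦ hK z (hST hz)⟩) ?_ ?_
  · rintro S T ⟨K, hK⟩ ⟨K', hK'⟩
    refine ⟨max K K', ?_⟩
    rintro z (hz | hz)
    · refine (hK z hz).trans ?_
      gcongr
      exact le_max_left _ _
    · refine (hK' z hz).trans ?_
      gcongr
      exact le_max_right _ _
  · rintro ⟨s, t⟩ ⟨hs, ht⟩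
    simp only at hs ht
    by_cases hst : s = t
    · subst hst
      obtain ⟨e, he⟩ := hP.exists_equiv hs
      have hpos : 0 < ‖(e.symm : Plane →L[ℝ] Plane)‖₊⁻¹ :=
        inv_pos.2 (e.subsingleton_or_nnnorm_symm_pos.resolve_left (not_subsingleton _))
      obtain ⟨V, hV, hV'⟩ := he.approximates_deriv_on_nhds
        (c := ‖(e.symm : Plane →L[ℝ] Plane)‖₊⁻¹ / 2) (.inr (half_pos hpos))
      have hanti := hV'.antilipschitz (.inr (half_lt_self hpos))
      refine ⟨V ×ˢ V, nhdsWithin_le_nhds (prod_mem_nhds hV hV),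
        (‖(e.symm : Plane →L[ℝ] Plane)‖₊⁻¹ - ‖(e.symm : Plane →L[ℝ] Plane)‖₊⁻¹ / 2)⁻¹,
        fun z hz ↦ ?_⟩
      exact hanti.le_mul_dist ⟨z.1, hz.1⟩ ⟨z.2, hz.2⟩
    · have hD : 0 < dist (quadMap P s) (quadMap P t) :=
        dist_pos.2 fun h ↦ hst (hP.1 hs ht h)
      set K : ℝ≥0 := nndist s t / nndist (quadMap P s) (quadMap P t) + 1
      have hlt : dist s t < K * dist (quadMap P s) (quadMap P t) := by
        have : (K : ℝ) * dist (quadMap P s) (quadMap P t)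
            = dist s t + dist (quadMap P s) (quadMap P t) := by
          simp only [K, NNReal.coe_add, NNReal.coe_div, coe_nndist, NNReal.coe_one]
          field_simp
        linarith
      have hev : ∀ᶠ z : Plane × Plane in 𝓝 (s, t),
          dist z.1 z.2 < K * dist (quadMap P z.1) (quadMap P z.2) := by
        refine ContinuousAt.eventually_lt (f := fun z : Plane × Plane ↦ dist z.1 z.2)
          (g := fun z : Plane × Plane ↦ K * dist (quadMap P z.1) (quadMap P z.2)) ?_ ?_ hlt
        · fun_prop
        · exact (by fun_prop : Continuous fun z : Plane × Plane ↦
            (K : ℝ) * dist (quadMap P z.1) (quadMap P z.2)).continuousAt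
      exact ⟨_, nhdsWithin_le_nhds hev, K, fun z hz ↦ le_of_lt hz⟩

/-- A function whose pullback to the reference square is smooth is Lipschitz on the cell. -/
lemma IsQuad.exists_lipschitzOnWith (hP : IsQuad P) {f g : Plane → ℝ} (hg : ContDiff ℝ ∞ g)
    (hfg : ∀ s ∈ refSquare, f (quadMap P s) = g s) : ∃ K, LipschitzOnWith K f (cell P) := by
  obtain ⟨K, hK⟩ := hP.exists_dist_le
  obtain ⟨L, hL⟩ := hg.contDiffOn.exists_lipschitzOnWith (by simp) convex_refSquare
    isCompact_refSquare
  refine ⟨L * K, LipschitzOnWith.of_dist_le_mul ?_⟩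
  rintro _ ⟨s, hs, rfl⟩ _ ⟨t, ht, rfl⟩
  rw [hfg s hs, hfg t ht, NNReal.coe_mul, mul_assoc]
  exact (hL.dist_le_mul s hs t ht).trans (by gcongr; exact hK s hs t ht)

open Classical in
/-- The biquadratic bubble of the quadrilateral, extended by zero to the plane. -/
def bubble (P : Fin 4 → Plane) (x : Plane) : ℝ :=
  if x ∈ cell P then refBubble (Function.invFunOn (quadMap P) refSquare x) else 0

lemma IsQuad.bubble_quadMap (hP : IsQuad P) {s : Plane} (hs : s ∈ refSquare) :
    bubble P (quadMap P s) = refBubble s := by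
  rw [bubble, if_pos ⟨s, hs, rfl⟩, hP.1.leftInvOn_invFunOn hs]

lemma IsQuad.bubble_eq_zero (hP : IsQuad P) {x : Plane} (hx : x ∉ openCell P) :
    bubble P x = 0 := by
  by_cases h : x ∈ cell P
  · obtain ⟨s, hs, rfl⟩ := h
    rw [hP.bubble_quadMap hs]
    exact refBubble_eq_zero hs fun hs' ↦ hx ⟨s, hs', rfl⟩
  · rw [bubble, if_neg h]

lemma IsQuad.bubble_pos (hP : IsQuad P) {x : Plane} (hx : x ∈ openCell P) : 0 < bubble P x := by
  obtain ⟨s, hs, rfl⟩ := hx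
  rw [hP.bubble_quadMap (refSquareOpen_subset hs)]
  exact refBubble_pos hs

lemma IsQuad.exists_lipschitzWith_bubble (hP : IsQuad P) : ∃ K, LipschitzWith K (bubble P) := by
  refine exists_lipschitzWith_of_closed_cover (S := fun i : Bool ↦ bif i then cell P
    else (openCell P)ᶜ) ?_ ?_ ?_
  · rintro (_ | _)
    · exact hP.isOpen_openCell.isClosed_compl
    · exact (isCompact_cell P).isClosed
  · rw [← Set.union_eq_iUnion, ← Set.compl_subset_iff_union]
    exact Set.compl_subset_compl.2 (openCell_subset_cell P)
  · rintro (_ | _)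
    · refine ⟨0, LipschitzOnWith.of_dist_le_mul fun x hx y hy ↦ ?_⟩
      rw [hP.bubble_eq_zero hx, hP.bubble_eq_zero hy]
      simp
    · exact hP.exists_lipschitzOnWith contDiff_refBubble fun s hs ↦ hP.bubble_quadMap hs

lemma volume_cell_diff (P : Fin 4 → Plane) : volume (cell P \ openCell P) = 0 := by
  refine measure_mono_null (t := quadMap P '' (refSquare \ refSquareOpen)) ?_ ?_
  · rintro _ ⟨⟨s, hs, rfl⟩, hx⟩
    exact ⟨s, ⟨hs, fun hs' ↦ hx ⟨s, hs', rfl⟩⟩, rfl⟩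
  · exact addHaar_image_eq_zero_of_differentiableOn_of_addHaar_eq_zero volume
      ((contDiff_quadMap P).differentiable (by simp)).differentiableOn volume_refSquare_diff

end Quad

/-! ### Meshes -/

section Mesh

variable {τ : Type*} {Ω : Set Plane} {P : τ → Fin 4 → Plane}

lemma IsQuadMesh.cell_subset (hP : IsQuadMesh Ω P) (T : τ) : cell (P T) ⊆ closure Ω :=
  hP.cover ▸ Set.subset_iUnion (fun T ↦ cell (P T)) T

lemma IsQuadMesh.disjoint_cell (hP : IsQuadMesh Ω P) {T T' : τ} (h : T ≠ T') :
    Disjoint (openCell (P T)) (cell (P T')) :=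
  ((hP.disjoint T T' h).closure_right (hP.isQuad T).isOpen_openCell).mono_right
    (cell_subset_closure_openCell _)

lemma IsQuadMesh.ae_mem_openCell [Finite τ] (hP : IsQuadMesh Ω P) (hΩ : IsOpen Ω) :
    ∀ᵐ x ∂(volume.restrict Ω), ∃ T, x ∈ openCell (P T) := by
  have h0 : volume (⋃ T, cell (P T) \ openCell (P T)) = 0 :=
    measure_iUnion_null fun T ↦ volume_cell_diff (P T)
  rw [ae_restrict_iff' hΩ.measurableSet]
  filter_upwards [measure_eq_zero_iff_ae_notMem.1 h0] with x hx hxΩ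
  by_contra! hcon
  have : x ∈ ⋃ T, cell (P T) := hP.cover ▸ subset_closure hxΩ
  obtain ⟨T, hT⟩ := Set.mem_iUnion.1 this
  exact hx (Set.mem_iUnion.2 ⟨T, hT, hcon T⟩)

/-- A `Q_m` function that vanishes on the boundary, extended by zero, is Lipschitz. -/
lemma IsQm.exists_lipschitzWith [Finite τ] (hP : IsQuadMesh Ω P) (hΩ : IsOpen Ω) {m : ℕ}
    {q q₀ : Plane → ℝ} (hq : IsQm Ω P m q) (h : ∀ x ∈ closure Ω, q₀ x = q x)
    (h0 : ∀ x ∉ Ω, q₀ x = 0) : ∃ K, LipschitzWith K q₀ := by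
  refine exists_lipschitzWith_of_closed_cover
    (S := fun i : Option τ ↦ i.elim Ωᶜ fun T ↦ cell (P T)) ?_ ?_ ?_
  · rintro (_ | T)
    · exact hΩ.isClosed_compl
    · exact (isCompact_cell _).isClosed
  · rw [Set.iUnion_option]
    simp only [Option.elim_none, Option.elim_some]
    rw [hP.cover, ← Set.compl_subset_iff_union, compl_compl]
    exact subset_closure
  · rintro (_ | T)
    · refine ⟨0, LipschitzOnWith.of_dist_le_mul fun x hx y hy ↦ ?_⟩
      rw [h0 x hx, h0 y hy]
      simp
    · obtain ⟨c, hc⟩ := hq.2 T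
      exact (hP.isQuad T).exists_lipschitzOnWith (contDiff_qPoly m c) fun s hs ↦
        (h _ (hP.cell_subset T ⟨s, hs, rfl⟩)).trans (hc s hs)

/-- A bubble field is, on all of `Ω`, a Lipschitz multiple of `n`. -/
lemma IsBubble.exists_lipschitzWith [Finite τ] (hP : IsQuadMesh Ω P) {n w : Plane → Vec}
    (hw : IsBubble Ω P n w) :
    ∃ B : Plane → ℝ, (∃ K, LipschitzWith K B) ∧ (∀ x ∉ Ω, B x = 0) ∧
      ∀ x ∈ Ω, w x = B x • n x := by
  have := Fintype.ofFinite τ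
  choose a ha using hw.2.2
  choose K hK using fun T ↦ (hP.isQuad T).exists_lipschitzWith_bubble
  refine ⟨fun x ↦ ∑ T, a T * bubble (P T) x, ?_, fun x hx ↦ ?_, fun x hx ↦ ?_⟩
  · refine ⟨∑ T, ‖a T‖₊ * K T, LipschitzWith.of_dist_le_mul fun x y ↦ ?_⟩
    rw [dist_eq_norm, ← Finset.sum_sub_distrib, NNReal.coe_sum, Finset.sum_mul]
    refine norm_sum_le_of_le _ fun T _ ↦ ?_
    rw [← mul_sub, norm_mul, NNReal.coe_mul, coe_nnnorm, mul_assoc, ← dist_eq_norm]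
    gcongr
    exact (hK T).dist_le_mul x y
  · refine Finset.sum_eq_zero fun T _ ↦ ?_
    rw [(hP.isQuad T).bubble_eq_zero fun h ↦ hx (hP.open_subset T h), mul_zero]
  · have hx' : x ∈ ⋃ T, cell (P T) := hP.cover ▸ subset_closure hx
    obtain ⟨T, s, hs, rfl⟩ := Set.mem_iUnion.1 hx'
    beta_reduce
    rw [ha T s hs, Finset.sum_eq_single T, (hP.isQuad T).bubble_quadMap hs]
    · intro T' _ hT'
      rw [(hP.isQuad T').bubble_eq_zero, mul_zero]
      exact fun hmem ↦ Set.disjoint_left.1 (hP.disjoint_cell hT') hmem ⟨s, hs, rfl⟩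
    · simp

/-- The multiple of `n` by the bubble of a single cell. -/
lemma isBubble_bubble (hP : IsQuadMesh Ω P) (hΩ : IsOpen Ω) {n : Plane → Vec}
    (hn : ContinuousOn n Ω) {C : ℝ} (hC : ∀ x ∈ Ω, ‖n x‖ ≤ C) (T : τ) :
    IsBubble Ω P n (fun x ↦ bubble (P T) x • n x) := by
  obtain ⟨K, hK⟩ := (hP.isQuad T).exists_lipschitzWith_bubble
  have hzero : ∀ x ∉ Ω, bubble (P T) x = 0 := fun x hx ↦
    (hP.isQuad T).bubble_eq_zero fun h ↦ hx (hP.open_subset T h)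
  refine ⟨Continuous.continuousOn (continuous_iff_continuousAt.2 fun x ↦ ?_), fun x hx ↦ ?_,
    fun T' ↦ ?_⟩
  · by_cases hx : x ∈ Ω
    · exact hK.continuous.continuousAt.smul (hn.continuousAt (hΩ.mem_nhds hx))
    · -- outside `Ω` only boundedness of `n` is available, and it suffices
      rw [ContinuousAt, hzero x hx, zero_smul]
      have hlim : Tendsto (fun y ↦ ‖bubble (P T) y‖ * C) (𝓝 x) (𝓝 0) := by
        have := (hK.continuous.tendsto x).norm.mul_const C
        rwa [hzero x hx, norm_zero, zero_mul] at this
      refine squeeze_zero_norm (fun y ↦ ?_) hlim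
      by_cases hy : y ∈ Ω
      · rw [norm_smul]
        gcongr
        exact hC y hy
      · simp [hzero y hy]
  · rw [hΩ.frontier_eq] at hx
    simp [hzero x hx.2]
  · by_cases h : T' = T
    · subst h
      exact ⟨1, fun s hs ↦ by beta_reduce; rw [(hP.isQuad T').bubble_quadMap hs, one_mul]⟩
    · refine ⟨0, fun s hs ↦ ?_⟩
      beta_reduce
      rw [(hP.isQuad T).bubble_eq_zero]
      · simp
      · exact fun hmem ↦ Set.disjoint_left.1 (hP.disjoint_cell (Ne.symm h)) hmem ⟨s, hs, rfl⟩

end Mesh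

/-! ### Lipschitz functions as test functions -/

/-- The partial derivative of a Lipschitz function, as a line derivative; by Rademacher's theorem
it is the classical one almost everywhere. -/
def lpd (i : Fin 2) (f : Plane → ℝ) (x : Plane) : ℝ :=
  lineDeriv ℝ f x (EuclideanSpace.single i 1)

lemma pd_eq_lpd {f : Plane → ℝ} {x : Plane} (h : DifferentiableAt ℝ f x) (i : Fin 2) :
    pd i f x = lpd i f x :=
  h.lineDeriv_eq_fderiv.symm

lemma measurable_lpd {K : ℝ≥0} {f : Plane → ℝ} (hf : LipschitzWith K f) (i : Fin 2) :
    Measurable (lpd i f) :=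
  measurable_lineDeriv hf.continuous

lemma norm_lpd_le {K : ℝ≥0} {f : Plane → ℝ} (hf : LipschitzWith K f) (i : Fin 2) (x : Plane) :
    ‖lpd i f x‖ ≤ K := by
  simpa [lpd] using norm_lineDeriv_le_of_lipschitz ℝ hf (x₀ := x) (v := EuclideanSpace.single i (1 : ℝ))

lemma memLp_lpd {K : ℝ≥0} {f : Plane → ℝ} (hf : LipschitzWith K f) (i : Fin 2) (μ : Measure Plane) :
    MemLp (lpd i f) ∞ μ :=
  memLp_top_of_bound (measurable_lpd hf i).aestronglyMeasurable K (.of_forall (norm_lpd_le hf i))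

/-- Differentiation under a convolution with a Lipschitz function: the derivative may be moved from
the smooth factor to the Lipschitz one. -/
lemma pd_convolution {K : ℝ≥0} {f φ : Plane → ℝ} (hf : LipschitzWith K f) (hφ : ContDiff ℝ ∞ φ)
    (hφc : HasCompactSupport φ) (i : Fin 2) (x : Plane) :
    pd i (φ ⋆[ContinuousLinearMap.lsmul ℝ ℝ, volume] f) x
      = (φ ⋆[ContinuousLinearMap.lsmul ℝ ℝ, volume] lpd i f) x := by
  have hloc : LocallyIntegrable f volume := hf.continuous.locallyIntegrable
  set e : Plane := EuclideanSpace.single i 1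
  have h1 := (hφc.hasFDerivAt_convolution_left (ContinuousLinearMap.lsmul ℝ ℝ)
    (hφ.of_le (by simp)) hloc x).fderiv
  have hint := (hφc.fderiv (𝕜 := ℝ)).convolutionExists_left
    ((ContinuousLinearMap.lsmul ℝ ℝ : ℝ →L[ℝ] ℝ →L[ℝ] ℝ).precompL Plane)
    (hφ.continuous_fderiv (by simp)) hloc x
  have h2 : pd i (φ ⋆[ContinuousLinearMap.lsmul ℝ ℝ, volume] f) x
      = ∫ t, lineDeriv ℝ φ t e * f (x - t) := by
    rw [pd, h1, convolution_def, ContinuousLinearMap.integral_apply hint]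
    refine integral_congr_ae (.of_forall fun t ↦ ?_)
    beta_reduce
    rw [(hφ.differentiable (by simp) t).lineDeriv_eq_fderiv]
    rfl
  have hF : LipschitzWith K fun t ↦ f (x - t) := by
    have : LipschitzWith 1 fun t : Plane ↦ x - t :=
      LipschitzWith.of_dist_le_mul fun s t ↦ by
        rw [dist_sub_left, NNReal.coe_one, one_mul]
    have h := hf.comp this
    rwa [mul_one] at h
  obtain ⟨D, hD⟩ := hφ.lipschitzWith_of_hasCompactSupport hφc (by simp)
  have h3 := hF.integral_lineDeriv_mul_eq (μ := volume) hD hφc (-e)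
  rw [neg_neg] at h3
  rw [h2, ← h3, convolution_lsmul]
  refine integral_congr_ae (.of_forall fun t ↦ ?_)
  have : lineDeriv ℝ (fun t ↦ f (x - t)) t (-e) = lpd i f (x - t) := by
    simp only [lineDeriv, lpd]
    congr 1
    funext s
    congr 1
    simp only [e]
    module
  beta_reduce
  rw [this, smul_eq_mul, mul_comm]

/-- Mollification: a compactly supported Lipschitz function in `Ω` is a bounded limit of test
functions, together with its first derivatives. -/
lemma exists_isTest_tendsto {Ω : Set Plane} (hΩ : IsOpen Ω) {K : ℝ≥0} {f : Plane → ℝ}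
    (hf : LipschitzWith K f) (hfc : HasCompactSupport f) (hfΩ : tsupport f ⊆ Ω) :
    ∃ (η : ℕ → Plane → ℝ) (M : ℝ), (∀ j, IsTest Ω (η j)) ∧
      (∀ j x, ‖η j x‖ ≤ M) ∧ (∀ j i x, ‖pd i (η j) x‖ ≤ M) ∧
      (∀ x, Tendsto (fun j ↦ η j x) atTop (𝓝 (f x))) ∧
      ∀ i, ∀ᵐ x, Tendsto (fun j ↦ pd i (η j) x) atTop (𝓝 (lpd i f x)) := by
  obtain ⟨δ, hδ, hδΩ⟩ := hfc.isCompact.exists_cthickening_subset_open hΩ hfΩ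
  obtain ⟨C, hC⟩ := hf.continuous.bounded_above_of_compact_support hfc
  have hC0 : 0 ≤ C := (norm_nonneg _).trans (hC 0)
  let φ : ℕ → ContDiffBump (0 : Plane) := fun j ↦
    { rIn := δ / (j + 1) / 2
      rOut := δ / (j + 1)
      rIn_pos := by positivity
      rIn_lt_rOut := half_lt_self (by positivity) }
  have hφ0 : Tendsto (fun j ↦ (φ j).rOut) atTop (𝓝 0) := by
    have := (tendsto_one_div_add_atTop_nhds_zero_nat (𝕜 := ℝ)).const_mul δ
    simpa [φ, div_eq_mul_inv] using this
  have hφδ : ∀ j, (φ j).rOut ≤ δ := fun j ↦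
    div_le_self hδ.le (by linarith [(Nat.cast_nonneg j : (0 : ℝ) ≤ j)])
  have hbound : ∀ {g : Plane → ℝ} {M : ℝ}, AEStronglyMeasurable g volume → (∀ x, ‖g x‖ ≤ M) →
      ∀ j x, ‖((φ j).normed volume ⋆[ContinuousLinearMap.lsmul ℝ ℝ, volume] g) x‖ ≤ M := by
    intro g M hg hgM j x
    rw [← dist_zero_right]
    refine dist_convolution_le ((norm_nonneg _).trans (hgM 0)) ((φ j).support_normed_eq).le
      (fun t ↦ (φ j).nonneg_normed t) (φ j).integral_normed hg fun t _ ↦ ?_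
    rw [dist_zero_right]
    exact hgM t
  have hpd : ∀ j i, pd i ((φ j).normed volume ⋆[ContinuousLinearMap.lsmul ℝ ℝ, volume] f)
      = (φ j).normed volume ⋆[ContinuousLinearMap.lsmul ℝ ℝ, volume] lpd i f := fun j i ↦
    funext (pd_convolution hf (φ j).contDiff_normed (φ j).hasCompactSupport_normed i)
  have hsupp : ∀ j, tsupport ((φ j).normed volume ⋆[ContinuousLinearMap.lsmul ℝ ℝ, volume] f)
      ⊆ Metric.cthickening δ (tsupport f) := by
    intro j
    refine closure_minimal ?_ Metric.isClosed_cthickening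
    refine (support_convolution_subset _).trans ?_
    rintro _ ⟨s, hs, t, ht, rfl⟩
    rw [(φ j).support_normed_eq] at hs
    refine Metric.mem_cthickening_of_dist_le _ t δ _ (subset_tsupport f ht) ?_
    rw [dist_eq_norm, add_sub_cancel_right, ← dist_zero_right]
    exact (Metric.mem_ball.1 hs).le.trans (hφδ j)
  refine ⟨fun j ↦ (φ j).normed volume ⋆[ContinuousLinearMap.lsmul ℝ ℝ, volume] f, max C K,
    fun j ↦ ⟨?_, ?_, (hsupp j).trans hδΩ⟩, ?_, ?_, ?_, ?_⟩
  · exact (φ j).hasCompactSupport_normed.contDiff_convolution_left _ (φ j).contDiff_normed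
      hf.continuous.locallyIntegrable
  · exact hfc.isCompact.cthickening.of_isClosed_subset (isClosed_tsupport _) (hsupp j)
  · exact hbound hf.continuous.aestronglyMeasurable fun x ↦ (hC x).trans (le_max_left _ _)
  · intro j i x
    rw [hpd]
    exact hbound (measurable_lpd hf i).aestronglyMeasurable
      (fun x ↦ (norm_lpd_le hf i x).trans (le_max_right _ _)) j x
  · exact fun x ↦ ContDiffBump.convolution_tendsto_right_of_continuous hφ0 hf.continuous x
  · intro i
    simp only [hpd]
    refine ContDiffBump.ae_convolution_tendsto_right_of_locallyIntegrable (K := 2) hφ0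
      (.of_forall fun j ↦ ?_) (hf.locallyIntegrable_lineDeriv _)
    simp only [φ]
    linarith

/-- Dominated convergence against a fixed `L²` function on a set of finite measure. -/
lemma tendsto_setIntegral_mul {Ω : Set Plane} [IsFiniteMeasure (volume.restrict Ω)]
    {u : Plane → ℝ} (hu : MemLp u 2 (volume.restrict Ω)) {F : ℕ → Plane → ℝ} {G : Plane → ℝ} {M : ℝ}
    (hF : ∀ j, Continuous (F j)) (hM : ∀ j x, ‖F j x‖ ≤ M)
    (hlim : ∀ᵐ x, Tendsto (fun j ↦ F j x) atTop (𝓝 (G x))) :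
    Tendsto (fun j ↦ ∫ x in Ω, u x * F j x) atTop (𝓝 (∫ x in Ω, u x * G x)) := by
  refine tendsto_integral_of_dominated_convergence (fun x ↦ ‖u x‖ * M)
    (fun j ↦ hu.1.mul (hF j).aestronglyMeasurable)
    ((hu.integrable (by norm_num)).norm.mul_const M) (fun j ↦ .of_forall fun x ↦ ?_) ?_
  · rw [norm_mul]
    gcongr
    exact hM j x
  · filter_upwards [ae_restrict_of_ae hlim] with x hx using hx.const_mul _

section Product

variable {Ω : Set Plane}

lemma lipschitzWith_mul_test {B η : Plane → ℝ} {K : ℝ≥0} (hB : LipschitzWith K B)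
    (hBc : HasCompactSupport B) (hη : IsTest Ω η) : ∃ K, LipschitzWith K fun x ↦ B x * η x := by
  obtain ⟨D, hD⟩ := hη.1.lipschitzWith_of_hasCompactSupport hη.2.1 (by simp)
  obtain ⟨b, hb⟩ := hB.continuous.bounded_above_of_compact_support hBc
  obtain ⟨h, hh⟩ := hη.1.continuous.bounded_above_of_compact_support hη.2.1
  refine ⟨b.toNNReal * D + h.toNNReal * K, LipschitzWith.of_dist_le_mul fun x y ↦ ?_⟩
  have hb0 : 0 ≤ b := (norm_nonneg _).trans (hb 0)
  have hh0 : 0 ≤ h := (norm_nonneg _).trans (hh 0)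
  have e : B x * η x - B y * η y = B x * (η x - η y) + η y * (B x - B y) := by ring
  have h1 := hD.dist_le_mul x y
  have h2 := hB.dist_le_mul x y
  rw [dist_eq_norm] at h1 h2
  simp only [NNReal.coe_add, NNReal.coe_mul, Real.coe_toNNReal _ hb0, Real.coe_toNNReal _ hh0]
  rw [dist_eq_norm, e, add_mul, mul_assoc, mul_assoc]
  refine norm_add_le_of_le ?_ ?_ <;> rw [norm_mul]
  · exact mul_le_mul (hb x) h1 (norm_nonneg _) hb0
  · exact mul_le_mul (hh y) h2 (norm_nonneg _) hh0

lemma lpd_mul_test {B η : Plane → ℝ} {K : ℝ≥0} (hB : LipschitzWith K B) (hη : IsTest Ω η)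
    (i : Fin 2) :
    ∀ᵐ x, lpd i (fun y ↦ B y * η y) x = B x * pd i η x + η x * lpd i B x := by
  filter_upwards [hB.ae_differentiableAt (μ := volume)] with x hx
  have hηx := hη.1.differentiable (by simp) x
  rw [← pd_eq_lpd (hx.fun_mul hηx), ← pd_eq_lpd hx]
  simp [pd, fderiv_fun_mul hx hηx]

/-- Approximation of the product of a Lipschitz function and a test function by test functions. -/
lemma exists_isTest_tendsto_mul (hΩ : IsOpen Ω) {B η : Plane → ℝ} {K : ℝ≥0}
    (hB : LipschitzWith K B) (hBc : HasCompactSupport B) (hη : IsTest Ω η) :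
    ∃ (ζ : ℕ → Plane → ℝ) (M : ℝ), (∀ j, IsTest Ω (ζ j)) ∧
      (∀ j x, ‖ζ j x‖ ≤ M) ∧ (∀ j i x, ‖pd i (ζ j) x‖ ≤ M) ∧
      (∀ x, Tendsto (fun j ↦ ζ j x) atTop (𝓝 (B x * η x))) ∧
      ∀ i, ∀ᵐ x, Tendsto (fun j ↦ pd i (ζ j) x) atTop (𝓝 (B x * pd i η x + η x * lpd i B x)) := by
  obtain ⟨D, hD⟩ := lipschitzWith_mul_test hB hBc hη
  obtain ⟨ζ, M, h1, h2, h3, h4, h5⟩ := exists_isTest_tendsto hΩ hD hη.2.1.mul_left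
    ((tsupport_mul_subset_right).trans hη.2.2)
  refine ⟨ζ, M, h1, h2, h3, h4, fun i ↦ ?_⟩
  filter_upwards [h5 i, lpd_mul_test hB hη i] with x hx hx'
  rwa [← hx']

/-- A weak divergence may be tested with the product of a Lipschitz function and a test
function. -/
lemma IsWeakDiv.integral_mul (hΩ : IsOpen Ω) [IsFiniteMeasure (volume.restrict Ω)]
    {v : Plane → Vec} {d : Plane → ℝ} (hv : MemLp v 2 (volume.restrict Ω)) (h : IsWeakDiv Ω v d)
    {B η : Plane → ℝ} {K : ℝ≥0} (hB : LipschitzWith K B) (hBc : HasCompactSupport B)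
    (hη : IsTest Ω η) :
    (∫ x in Ω, v x 0 * (B x * pd 0 η x + η x * lpd 0 B x))
      + ∫ x in Ω, v x 1 * (B x * pd 1 η x + η x * lpd 1 B x)
      = - ∫ x in Ω, d x * (B x * η x) := by
  obtain ⟨ζ, M, h1, h2, h3, h4, h5⟩ := exists_isTest_tendsto_mul hΩ hB hBc hη
  have hlim (i : Fin 2) (a : Fin 3) := tendsto_setIntegral_mul (hv.eval a)
    (fun j ↦ (h1 j).continuous_pd i) (fun j ↦ h3 j i) (h5 i)
  have hlim0 := tendsto_setIntegral_mul h.1 (fun j ↦ (h1 j).1.continuous) h2 (.of_forall h4)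
  refine tendsto_nhds_unique ((hlim 0 0).add (hlim 1 1)) (hlim0.neg.congr fun j ↦ ?_)
  rw [← h.2 _ (h1 j), ← integral_add (integrable_mul_of_memLp (hv.eval _) ((h1 j).memLp_pd _ 2))
    (integrable_mul_of_memLp (hv.eval _) ((h1 j).memLp_pd _ 2))]
  simp [cgrad, dotProduct, Fin.sum_univ_three]

/-- Product rule: `∇ · (B v) = B ∇ · v + ∇B · v` for Lipschitz `B`. -/
lemma IsWeakDiv.lipschitz_smul (hΩ : IsOpen Ω) [IsFiniteMeasure (volume.restrict Ω)]
    {v : Plane → Vec} {d : Plane → ℝ} (hv : MemLp v 2 (volume.restrict Ω)) (h : IsWeakDiv Ω v d)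
    {B : Plane → ℝ} {K : ℝ≥0} (hB : LipschitzWith K B) (hBc : HasCompactSupport B) :
    IsWeakDiv Ω (fun x ↦ B x • v x)
      (fun x ↦ B x * d x + (lpd 0 B x * v x 0 + lpd 1 B x * v x 1)) := by
  have hBt : MemLp B ∞ (volume.restrict Ω) := hB.continuous.memLp_of_hasCompactSupport hBc
  have hl (i : Fin 2) (a : Fin 3) :
      MemLp (fun x ↦ lpd i B x * v x a) 2 (volume.restrict Ω) :=
    memLp_mul (memLp_lpd hB i _) (hv.eval a)
  have hd : MemLp (fun x ↦ B x * d x) 2 (volume.restrict Ω) := memLp_mul hBt h.1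
  refine ⟨hd.add ((hl 0 0).add (hl 1 1)), fun η hη ↦ ?_⟩
  have hη2 := hη.memLp 2
  have hg (i : Fin 2) (a : Fin 3) :
      Integrable (fun x ↦ v x a * (B x * pd i η x)) (volume.restrict Ω) :=
    integrable_mul_of_memLp (hv.eval a) (memLp_mul hBt (hη.memLp_pd i 2))
  have hm (i : Fin 2) (a : Fin 3) :
      Integrable (fun x ↦ (lpd i B x * v x a) * η x) (volume.restrict Ω) :=
    integrable_mul_of_memLp (hl i a) hη2
  have hsplit (i : Fin 2) (a : Fin 3) :
      ∫ x in Ω, v x a * (B x * pd i η x + η x * lpd i B x)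
        = (∫ x in Ω, v x a * (B x * pd i η x)) + ∫ x in Ω, (lpd i B x * v x a) * η x := by
    rw [← integral_add (hg i a) (hm i a)]
    congr 1 with x
    ring
  have key := h.integral_mul hΩ hv hB hBc hη
  rw [hsplit, hsplit] at key
  have hL : ∫ x in Ω, (B x • v x) ⬝ᵥ cgrad η x
      = (∫ x in Ω, v x 0 * (B x * pd 0 η x)) + ∫ x in Ω, v x 1 * (B x * pd 1 η x) := by
    rw [← integral_add (hg 0 0) (hg 1 1)]
    congr 1 with x
    simp [cgrad, dotProduct, Fin.sum_univ_three]
    ring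
  have hR : ∫ x in Ω, (B x * d x + (lpd 0 B x * v x 0 + lpd 1 B x * v x 1)) * η x
      = (∫ x in Ω, d x * (B x * η x)) + ((∫ x in Ω, (lpd 0 B x * v x 0) * η x)
        + ∫ x in Ω, (lpd 1 B x * v x 1) * η x) := by
    rw [← integral_add (hm 0 0) (hm 1 1), ← integral_add]
    · congr 1 with x
      ring
    · exact integrable_mul_of_memLp h.1 (memLp_mul hBt hη2)
    · exact (hm 0 0).add (hm 1 1)
  rw [hL, hR]
  linarith

/-- The components of a weak curl are weak divergences of rotated fields. -/
lemma isWeakCurl_iff {v c : Plane → Vec} (hv : MemLp v 2 (volume.restrict Ω)) :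
    IsWeakCurl Ω v c ↔ IsWeakDiv Ω (fun x ↦ ![0, v x 2, 0]) (fun x ↦ c x 0) ∧
      IsWeakDiv Ω (fun x ↦ ![-v x 2, 0, 0]) (fun x ↦ c x 1) ∧
      IsWeakDiv Ω (fun x ↦ ![v x 1, -v x 0, 0]) (fun x ↦ c x 2) := by
  have hz (i : Fin 2) : pd i (fun _ : Plane ↦ (0 : ℝ)) = 0 := by
    funext x
    simp [pd]
  constructor
  · intro h
    refine ⟨⟨h.1.eval 0, fun η hη ↦ ?_⟩, ⟨h.1.eval 1, fun η hη ↦ ?_⟩,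
      ⟨h.1.eval 2, fun η hη ↦ ?_⟩⟩
    · have := h.2 _ (hη.single 0)
      simp only [dotProduct_single] at this
      rw [← this, ← integral_neg]
      congr 1 with x
      simp [ccurl, cgrad, dotProduct, Fin.sum_univ_three, hz]
    · have := h.2 _ (hη.single 1)
      simp only [dotProduct_single] at this
      rw [← this, ← integral_neg]
      congr 1 with x
      simp [ccurl, cgrad, dotProduct, Fin.sum_univ_three, hz]
    · have := h.2 _ (hη.single 2)
      simp only [dotProduct_single] at this
      rw [← this, ← integral_neg]
      congr 1 with x
      simp [ccurl, cgrad, dotProduct, Fin.sum_univ_three, hz]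
  · rintro ⟨h0, h1, h2⟩
    have hc : MemLp c 2 (volume.restrict Ω) := by
      refine MemLp.of_eval fun i ↦ ?_
      fin_cases i
      exacts [h0.1, h1.1, h2.1]
    refine ⟨hc, fun w hw ↦ ?_⟩
    have e0 := h0.2 _ (hw 0)
    have e1 := h1.2 _ (hw 1)
    have e2 := h2.2 _ (hw 2)
    have i0 : Integrable (fun x ↦ v x 2 * pd 1 (fun y ↦ w y 0) x) (volume.restrict Ω) :=
      integrable_mul_of_memLp (hv.eval 2) ((hw 0).memLp_pd 1 2)
    have i1 : Integrable (fun x ↦ v x 2 * pd 0 (fun y ↦ w y 1) x) (volume.restrict Ω) :=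
      integrable_mul_of_memLp (hv.eval 2) ((hw 1).memLp_pd 0 2)
    have i2 : Integrable (fun x ↦ v x 1 * pd 0 (fun y ↦ w y 2) x) (volume.restrict Ω) :=
      integrable_mul_of_memLp (hv.eval 1) ((hw 2).memLp_pd 0 2)
    have i3 : Integrable (fun x ↦ v x 0 * pd 1 (fun y ↦ w y 2) x) (volume.restrict Ω) :=
      integrable_mul_of_memLp (hv.eval 0) ((hw 2).memLp_pd 1 2)
    have j (i : Fin 3) : Integrable (fun x ↦ c x i * w x i) (volume.restrict Ω) :=
      integrable_mul_of_memLp (hc.eval i) ((hw i).memLp 2)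
    have hR : ∫ x in Ω, c x ⬝ᵥ w x = (∫ x in Ω, c x 0 * w x 0) + (∫ x in Ω, c x 1 * w x 1)
        + ∫ x in Ω, c x 2 * w x 2 := by
      have j01 : Integrable (fun x ↦ c x 0 * w x 0 + c x 1 * w x 1) (volume.restrict Ω) :=
        (j 0).add (j 1)
      rw [← integral_add (j 0) (j 1), ← integral_add j01 (j 2)]
      congr 1 with x
      simp [dotProduct, Fin.sum_univ_three]
    have hL : ∫ x in Ω, v x ⬝ᵥ ccurl w x = - (∫ x in Ω, v x 2 * pd 1 (fun y ↦ w y 0) x)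
        + (∫ x in Ω, v x 2 * pd 0 (fun y ↦ w y 1) x)
        - ((∫ x in Ω, v x 1 * pd 0 (fun y ↦ w y 2) x)
        - ∫ x in Ω, v x 0 * pd 1 (fun y ↦ w y 2) x) := by
      have k0 : Integrable (fun x ↦ -(v x 2 * pd 1 (fun y ↦ w y 0) x)) (volume.restrict Ω) :=
        i0.neg
      have k1 : Integrable (fun x ↦ -(v x 2 * pd 1 (fun y ↦ w y 0) x)
          + v x 2 * pd 0 (fun y ↦ w y 1) x) (volume.restrict Ω) := k0.add i1
      have k2 : Integrable (fun x ↦ v x 1 * pd 0 (fun y ↦ w y 2) x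
          - v x 0 * pd 1 (fun y ↦ w y 2) x) (volume.restrict Ω) := i2.sub i3
      rw [← integral_neg, ← integral_sub i2 i3, ← integral_add k0 i1, ← integral_sub k1 k2]
      congr 1 with x
      simp [ccurl, dotProduct, Fin.sum_univ_three]
      ring
    have f0 : ∫ x in Ω, ![0, v x 2, 0] ⬝ᵥ cgrad (fun y ↦ w y 0) x
        = ∫ x in Ω, v x 2 * pd 1 (fun y ↦ w y 0) x := by
      congr 1 with x
      simp [cgrad, dotProduct, Fin.sum_univ_three]
    have f1 : ∫ x in Ω, ![-v x 2, 0, 0] ⬝ᵥ cgrad (fun y ↦ w y 1) x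
        = - ∫ x in Ω, v x 2 * pd 0 (fun y ↦ w y 1) x := by
      rw [← integral_neg]
      congr 1 with x
      simp [cgrad, dotProduct, Fin.sum_univ_three]
    have f2 : ∫ x in Ω, ![v x 1, -v x 0, 0] ⬝ᵥ cgrad (fun y ↦ w y 2) x
        = (∫ x in Ω, v x 1 * pd 0 (fun y ↦ w y 2) x)
        - ∫ x in Ω, v x 0 * pd 1 (fun y ↦ w y 2) x := by
      rw [← integral_sub i2 i3]
      congr 1 with x
      simp [cgrad, dotProduct, Fin.sum_univ_three]
      ring
    rw [f0] at e0
    rw [f1] at e1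
    rw [f2] at e2
    rw [hL, hR]
    linarith

/-- `H(div) ∩ H(curl)` is stable under multiplication by compactly supported Lipschitz
functions. -/
lemma IsHDC.lipschitz_smul (hΩ : IsOpen Ω) [IsFiniteMeasure (volume.restrict Ω)]
    {v : Plane → Vec} (h : IsHDC Ω v) {B : Plane → ℝ} {K : ℝ≥0} (hB : LipschitzWith K B)
    (hBc : HasCompactSupport B) : IsHDC Ω (fun x ↦ B x • v x) := by
  have hBt : MemLp B ∞ (volume.restrict Ω) := hB.continuous.memLp_of_hasCompactSupport hBc
  obtain ⟨hv, ⟨d, hd⟩, c, hc⟩ := h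
  have hBv : MemLp (fun x ↦ B x • v x) 2 (volume.restrict Ω) :=
    MemLp.of_eval fun i ↦ memLp_mul hBt (hv.eval i)
  have hz : MemLp (fun _ : Plane ↦ (0 : ℝ)) 2 (volume.restrict Ω) := MemLp.zero
  have hrot {a b : Plane → ℝ} (ha : MemLp a 2 (volume.restrict Ω))
      (hb : MemLp b 2 (volume.restrict Ω)) :
      MemLp (fun x ↦ (![a x, b x, 0] : Vec)) 2 (volume.restrict Ω) := by
    refine MemLp.of_eval fun i ↦ ?_
    fin_cases i
    exacts [ha, hb, hz]
  obtain ⟨h0, h1, h2⟩ := (isWeakCurl_iff hv).1 hc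
  have p0 := h0.lipschitz_smul hΩ (hrot hz (hv.eval 2)) hB hBc
  have p1 := h1.lipschitz_smul hΩ (hrot (hv.eval 2).neg hz) hB hBc
  have p2 := h2.lipschitz_smul hΩ (hrot (hv.eval 1) (hv.eval 0).neg) hB hBc
  refine ⟨hBv, ⟨_, hd.lipschitz_smul hΩ hv hB hBc⟩, fun x ↦ ![_, _, _], (isWeakCurl_iff hBv).2
    ⟨p0.congr (.of_forall fun x ↦ ?_), p1.congr (.of_forall fun x ↦ ?_),
      p2.congr (.of_forall fun x ↦ ?_)⟩⟩ <;> simp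

/-- Constant fields are divergence-free: derivatives of test functions have integral zero. -/
lemma isWeakDiv_const (u : Vec) : IsWeakDiv Ω (fun _ ↦ u) (fun _ ↦ 0) := by
  refine ⟨MemLp.zero, fun η hη ↦ ?_⟩
  have hpd (i : Fin 2) : ∫ x in Ω, pd i η x = 0 := by
    rw [setIntegral_eq_integral_of_forall_compl_eq_zero]
    · obtain ⟨D, hD⟩ := hη.1.lipschitzWith_of_hasCompactSupport hη.2.1 (by simp)
      have := (LipschitzWith.const (1 : ℝ)).integral_lineDeriv_mul_eq (μ := volume) hD hη.2.1
        (-EuclideanSpace.single i (1 : ℝ) : Plane)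
      have hc : ∀ v : Plane, ∀ x, lineDeriv ℝ (fun _ : Plane ↦ (1 : ℝ)) x v = 0 := fun v x ↦ by
        simp [lineDeriv]
      simpa [hc, (hη.1.differentiable (by simp) _).lineDeriv_eq_fderiv, pd]
        using this.symm
    · intro x hx
      have : x ∉ tsupport η := fun h ↦ hx (hη.2.2 h)
      rw [pd, fderiv_of_notMem_tsupport (𝕜 := ℝ) this]
      rfl
  have : ∀ x, u ⬝ᵥ cgrad η x = u 0 * pd 0 η x + u 1 * pd 1 η x := fun x ↦ by
    simp [cgrad, dotProduct, Fin.sum_univ_three]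
  simp only [this, zero_mul, integral_zero, neg_zero]
  rw [integral_add ((memLp_one_iff_integrable.1 (hη.memLp_pd 0 1)).const_mul _)
    ((memLp_one_iff_integrable.1 (hη.memLp_pd 1 1)).const_mul _), integral_const_mul, integral_const_mul,
    hpd, hpd, mul_zero, mul_zero, add_zero]

lemma isHDC_const [IsFiniteMeasure (volume.restrict Ω)] (u : Vec) : IsHDC Ω (fun _ ↦ u) := by
  have hu : MemLp (fun _ : Plane ↦ u) 2 (volume.restrict Ω) := memLp_const u
  exact ⟨hu, ⟨_, isWeakDiv_const u⟩, fun _ ↦ ![0, 0, 0],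
    (isWeakCurl_iff hu).2 ⟨isWeakDiv_const ![0, u 2, 0], isWeakDiv_const ![-u 2, 0, 0],
      isWeakDiv_const ![u 1, -u 0, 0]⟩⟩

end Product

/-! ### The director space -/

section Director

variable {τ : Type*} {Ω : Set Plane} {P : τ → Fin 4 → Plane} {m : ℕ} {n : Plane → Vec}

lemma hasCompactSupport_of_eq_zero (hΩb : Bornology.IsBounded Ω) {f : Plane → ℝ}
    (h : ∀ x ∉ Ω, f x = 0) : HasCompactSupport f :=
  HasCompactSupport.intro hΩb.isCompact_closure fun x hx ↦ h x fun hx' ↦ hx (subset_closure hx')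

lemma Vh_continuousOn {v : Plane → Vec} (hv : v ∈ Vh Ω P m n) : ContinuousOn v (closure Ω) := by
  obtain ⟨_, q, w, hq, hw, hvq⟩ := hv
  refine ContinuousOn.congr (f := fun x ↦ q x + w x) ?_ hvq
  exact (continuousOn_pi.2 fun i ↦ (hq i).1).add hw.1

/-- The director space is a space of bounded fields. -/
lemma memLp_top_of_mem_Vh (hΩo : IsOpen Ω) (hΩb : Bornology.IsBounded Ω) {v : Plane → Vec}
    (hv : v ∈ Vh Ω P m n) : MemLp v ∞ (volume.restrict Ω) := by
  have hc := Vh_continuousOn hv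
  obtain ⟨C, hC⟩ := hΩb.isCompact_closure.exists_bound_of_continuousOn hc
  exact memLp_top_of_bound ((hc.mono subset_closure).aestronglyMeasurable hΩo.measurableSet) C
    ((ae_restrict_iff' hΩo.measurableSet).2 (.of_forall fun x hx ↦ hC x (subset_closure hx)))

/-- The director space is conforming: on `Ω` its elements are sums of Lipschitz multiples of the
coordinate fields and of `n`. -/
lemma isHDC_of_mem_Vh [Finite τ] (hP : IsQuadMesh Ω P) (hΩo : IsOpen Ω)
    (hΩb : Bornology.IsBounded Ω) (hn : IsHDC Ω n) {v : Plane → Vec} (hv : v ∈ Vh Ω P m n) :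
    IsHDC Ω v := by
  classical
  have : IsFiniteMeasure (volume.restrict Ω) := ⟨by simpa using hΩb.measure_lt_top⟩
  obtain ⟨hv0, q, w, hq, hw, hvq⟩ := hv
  obtain ⟨B, ⟨K, hBL⟩, hB0, hBw⟩ := hw.exists_lipschitzWith hP
  -- `q` vanishes on the boundary because `v` and the bubble field do
  let q₀ : Fin 3 → Plane → ℝ := fun i x ↦ if x ∈ Ω then q x i else 0
  have hq0 : ∀ i, ∀ x ∈ closure Ω, q₀ i x = q x i := by
    intro i x hx
    by_cases hxΩ : x ∈ Ω
    · simp [q₀, hxΩ]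
    · have h1 := hvq x hx
      rw [hv0 x hxΩ, hw.2.1 x (hΩo.frontier_eq ▸ ⟨hx, hxΩ⟩), add_zero] at h1
      simp [q₀, hxΩ, ← h1]
  have hqz : ∀ i, ∀ x ∉ Ω, q₀ i x = 0 := fun i x hx ↦ by simp [q₀, hx]
  choose L hL using fun i ↦ (hq i).exists_lipschitzWith hP hΩo (hq0 i) (hqz i)
  have hpiece (i : Fin 3) : IsHDC Ω fun x ↦ q₀ i x • (Pi.single i 1 : Vec) :=
    (isHDC_const _).lipschitz_smul hΩo (hL i) (hasCompactSupport_of_eq_zero hΩb (hqz i))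
  have hsum := (((hpiece 0).add (hpiece 1)).add (hpiece 2)).add
    (hn.lipschitz_smul hΩo hBL (hasCompactSupport_of_eq_zero hΩb hB0))
  refine hsum.congr ?_
  rw [EventuallyEq, ae_restrict_iff' hΩo.measurableSet]
  refine .of_forall fun x hx ↦ ?_
  rw [hvq x (subset_closure hx), hBw x hx]
  congr 1
  funext i
  rw [← hq0 i x (subset_closure hx)]
  fin_cases i <;> simp

end Director

/-! ### Bilinearity of the forms -/

section Bilinear

variable {X Y E E' : Type*} [AddCommGroup X] [Module ℝ X] [AddCommGroup Y] [Module ℝ Y]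
  [AddCommGroup E] [Module ℝ E] [AddCommGroup E'] [Module ℝ E']

lemma isBilinearMap_add {f g : X → Y → ℝ} (hf : IsBilinearMap ℝ f) (hg : IsBilinearMap ℝ g) :
    IsBilinearMap ℝ fun x y ↦ f x y + g x y where
  add_left x x' y := by rw [hf.add_left, hg.add_left]; ring
  smul_left r x y := by rw [hf.smul_left, hg.smul_left, smul_add]
  add_right x y y' := by rw [hf.add_right, hg.add_right]; ring
  smul_right r x y := by rw [hf.smul_right, hg.smul_right, smul_add]

lemma isBilinearMap_const_mul {f : X → Y → ℝ} (hf : IsBilinearMap ℝ f) (t : ℝ) :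
    IsBilinearMap ℝ fun x y ↦ t * f x y where
  add_left x x' y := by rw [hf.add_left, mul_add]
  smul_left r x y := by rw [hf.smul_left, smul_eq_mul, smul_eq_mul]; ring
  add_right x y y' := by rw [hf.add_right, mul_add]
  smul_right r x y := by rw [hf.smul_right, smul_eq_mul, smul_eq_mul]; ring

lemma isBilinearMap_sub {f g : X → Y → ℝ} (hf : IsBilinearMap ℝ f) (hg : IsBilinearMap ℝ g) :
    IsBilinearMap ℝ fun x y ↦ f x y - g x y := by
  simpa [sub_eq_add_neg] using isBilinearMap_add hf (isBilinearMap_const_mul hg (-1))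

/-- An operator with values in functions on the plane that is linear up to null sets. -/
structure IsAELinear (μ : Measure Plane) (D : X → Plane → E) : Prop where
  add : ∀ x y, D (x + y) =ᵐ[μ] fun p ↦ D x p + D y p
  smul : ∀ (r : ℝ) x, D (r • x) =ᵐ[μ] fun p ↦ r • D x p

/-- Integrals of pointwise bilinear expressions in linear operators are bilinear, provided that all
the integrands are integrable. -/
lemma IsAELinear.isBilinearMap_integral {μ : Measure Plane} {D : X → Plane → E}
    {D' : Y → Plane → E'} (hD : IsAELinear μ D) (hD' : IsAELinear μ D') (G : Plane → E → E' → ℝ)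
    (hG : ∀ p, IsBilinearMap ℝ (G p))
    (hint : ∀ x y, Integrable (fun p ↦ G p (D x p) (D' y p)) μ) :
    IsBilinearMap ℝ fun x y ↦ ∫ p, G p (D x p) (D' y p) ∂μ where
  add_left x x' y := by
    rw [← integral_add (hint x y) (hint x' y)]
    refine integral_congr_ae ?_
    filter_upwards [hD.add x x'] with p hp
    rw [hp, (hG p).add_left]
  smul_left r x y := by
    rw [← integral_smul]
    refine integral_congr_ae ?_
    filter_upwards [hD.smul r x] with p hp
    rw [hp, (hG p).smul_left]
  add_right x y y' := by
    rw [← integral_add (hint x y) (hint x y')]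
    refine integral_congr_ae ?_
    filter_upwards [hD'.add y y'] with p hp
    rw [hp, (hG p).add_right]
  smul_right r x y := by
    rw [← integral_smul]
    refine integral_congr_ae ?_
    filter_upwards [hD'.smul r y] with p hp
    rw [hp, (hG p).smul_right]

end Bilinear

/-- A field together with its weak divergence and its weak curl. -/
def jet (Ω : Set Plane) (v : Plane → Vec) (x : Plane) : Vec × ℝ × Vec :=
  (v x, wdiv Ω v x, wcurl Ω v x)

section Forms

variable {Ω : Set Plane}

lemma isAELinear_jet (hΩ : IsOpen Ω) {V : Submodule ℝ (Plane → Vec)} (hV : ∀ v ∈ V, IsHDC Ω v) :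
    IsAELinear (volume.restrict Ω) fun v : V ↦ jet Ω v where
  add u v := by
    filter_upwards [wdiv_add hΩ (hV u u.2) (hV v v.2), wcurl_add hΩ (hV u u.2) (hV v v.2)]
      with x h1 h2
    simp [jet, h1, h2]
  smul r v := by
    filter_upwards [wdiv_smul hΩ (hV v v.2) r, wcurl_smul hΩ (hV v v.2) r] with x h1 h2
    simp [jet, h1, h2]

lemma isAELinear_wgrad (hΩ : IsOpen Ω) {Φ : Submodule ℝ (Lp ℝ 2 (volume.restrict Ω))}
    (hΦ : ∀ ψ ∈ Φ, IsH1 Ω ψ) :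
    IsAELinear (volume.restrict Ω) fun ψ : Φ ↦ wgrad Ω (ψ : Lp ℝ 2 (volume.restrict Ω)) where
  add φ ψ := wgrad_coe_add hΩ (hΦ φ φ.2) (hΦ ψ ψ.2)
  smul r ψ := wgrad_coe_smul hΩ (hΦ ψ ψ.2) r

lemma isAELinear_coe {Γ : Submodule ℝ (Lp ℝ 2 (volume.restrict Ω))} :
    IsAELinear (volume.restrict Ω) fun γ : Γ ↦
      ((γ : Lp ℝ 2 (volume.restrict Ω)) : Plane → ℝ) where
  add _ _ := Lp.coeFn_add _ _
  smul _ _ := Lp.coeFn_smul _ _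

lemma memLp_Zmat_mulVec (p : Material) {n c : Plane → Vec} (hn : MemLp n ∞ (volume.restrict Ω))
    (hc : MemLp c 2 (volume.restrict Ω)) :
    MemLp (fun x ↦ Zmat p (n x) *ᵥ c x) 2 (volume.restrict Ω) := by
  have : (fun x ↦ Zmat p (n x) *ᵥ c x)
      = fun x ↦ c x - (1 - p.κ) • fun i ↦ n x i * (n x ⬝ᵥ c x) := by
    funext x
    rw [Zmat, sub_mulVec, one_mulVec, smul_mulVec, vecMulVec_mulVec]
    congr 2
  rw [this]
  have h : MemLp (fun x i ↦ n x i * (n x ⬝ᵥ c x)) 2 (volume.restrict Ω) :=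
    MemLp.of_eval fun i ↦ memLp_mul (p := ∞) (q := 2) (hn.eval i)
    (memLp_dot (p := ∞) (q := 2) hn hc)
  exact hc.sub (h.const_smul (1 - p.κ))

lemma isBilinearMap_aForm (hΩ : IsOpen Ω) [IsFiniteMeasure (volume.restrict Ω)]
    {V : Submodule ℝ (Plane → Vec)}
    (hV : ∀ v ∈ V, IsHDC Ω v) (hVb : ∀ v ∈ V, MemLp v ∞ (volume.restrict Ω)) (p : Material)
    {k : Iterate} (hn : IsHDC Ω k.n) (hnb : MemLp k.n ∞ (volume.restrict Ω))
    (hlam : MemLp k.lam 2 (volume.restrict Ω)) (hg : MemLp (wgrad Ω k.φ) ∞ (volume.restrict Ω)) :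
    IsBilinearMap ℝ fun u v : V ↦ aForm p Ω k u v := by
  have hJ := isAELinear_jet hΩ hV
  have hd : ∀ v : V, MemLp (wdiv Ω (v : Plane → Vec)) 2 (volume.restrict Ω) := fun v ↦
    (hV v v.2).memLp_wdiv
  have hc : ∀ v : V, MemLp (wcurl Ω (v : Plane → Vec)) 2 (volume.restrict Ω) := fun v ↦
    (hV v v.2).memLp_wcurl
  have hv : ∀ v : V, MemLp (v : Plane → Vec) 2 (volume.restrict Ω) := fun v ↦ (hV v v.2).1
  have hb : ∀ v : V, MemLp (v : Plane → Vec) ∞ (volume.restrict Ω) := fun v ↦ hVb v v.2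
  have hcn := hn.memLp_wcurl
  have mul {f g : Plane → ℝ} (hf : MemLp f 2 (volume.restrict Ω))
      (hg : MemLp g 2 (volume.restrict Ω)) := integrable_mul_of_memLp hf hg
  have dot {f g : Plane → Vec} (hf : MemLp f ∞ (volume.restrict Ω))
      (hg : MemLp g 2 (volume.restrict Ω)) : MemLp (fun x ↦ f x ⬝ᵥ g x) 2 (volume.restrict Ω) :=
    memLp_dot (p := ∞) (q := 2) hf hg
  have dot' {f g : Plane → Vec} (hf : MemLp f 2 (volume.restrict Ω))
      (hg : MemLp g ∞ (volume.restrict Ω)) : MemLp (fun x ↦ f x ⬝ᵥ g x) 2 (volume.restrict Ω) :=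
    memLp_dot (p := 2) (q := ∞) hf hg
  have cross {f g : Plane → Vec} (hf : MemLp f ∞ (volume.restrict Ω))
      (hg : MemLp g 2 (volume.restrict Ω)) : MemLp (fun x ↦ f x ⨯₃ g x) 2 (volume.restrict Ω) :=
    memLp_cross (p := ∞) (q := 2) hf hg
  have hg2 : ∀ v : V, MemLp (fun x ↦ (v : Plane → Vec) x ⬝ᵥ wgrad Ω k.φ x) 2
    (volume.restrict Ω) := fun v ↦ dot' (hv v) hg
  have t1 := hJ.isBilinearMap_integral hJ (fun _ a b ↦ a.2.1 * b.2.1)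
    (fun x ↦ by constructor <;> intros <;> simp <;> ring) fun u v ↦ mul (hd u) (hd v)
  have t2 := hJ.isBilinearMap_integral hJ (fun x a b ↦ (Zmat p (k.n x) *ᵥ a.2.2) ⬝ᵥ b.2.2)
    (fun x ↦ by constructor <;> intros <;> simp [mulVec_add, mulVec_smul])
    fun u v ↦ integrable_dot_of_memLp (memLp_Zmat_mulVec p hnb (hc u)) (hc v)
  have t3 := hJ.isBilinearMap_integral hJ
    (fun x a b ↦ (a.1 ⬝ᵥ b.2.2) * (k.n x ⬝ᵥ wcurl Ω k.n x))
    (fun x ↦ by constructor <;> intros <;> simp <;> ring)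
    fun u v ↦ mul (dot (hb u) (hc v)) (dot hnb hcn)
  have t4 := hJ.isBilinearMap_integral hJ
    (fun x a b ↦ (k.n x ⬝ᵥ b.2.2) * (a.1 ⬝ᵥ wcurl Ω k.n x))
    (fun x ↦ by constructor <;> intros <;> simp <;> ring)
    fun u v ↦ mul (dot hnb (hc v)) (dot (hb u) hcn)
  have t5 := hJ.isBilinearMap_integral hJ
    (fun x a b ↦ (k.n x ⬝ᵥ wcurl Ω k.n x) * (b.1 ⬝ᵥ a.2.2))
    (fun x ↦ by constructor <;> intros <;> simp <;> ring)
    fun u v ↦ mul (dot hnb hcn) (dot (hb v) (hc u))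
  have t6 := hJ.isBilinearMap_integral hJ
    (fun x a b ↦ (k.n x ⬝ᵥ a.2.2) * (b.1 ⬝ᵥ wcurl Ω k.n x))
    (fun x ↦ by constructor <;> intros <;> simp <;> ring)
    fun u v ↦ mul (dot hnb (hc u)) (dot (hb v) hcn)
  have t7 := hJ.isBilinearMap_integral hJ
    (fun x a b ↦ (a.1 ⬝ᵥ wcurl Ω k.n x) * (b.1 ⬝ᵥ wcurl Ω k.n x))
    (fun x ↦ by constructor <;> intros <;> simp <;> ring)
    fun u v ↦ mul (dot (hb u) hcn) (dot (hb v) hcn)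
  have t8 := hJ.isBilinearMap_integral hJ (fun x a b ↦ k.lam x * (a.1 ⬝ᵥ b.1))
    (fun x ↦ by constructor <;> intros <;> simp <;> ring)
    fun u v ↦ mul hlam (dot (hb u) (hv v))
  have t9 := hJ.isBilinearMap_integral hJ
    (fun x a b ↦ (a.1 ⬝ᵥ wgrad Ω k.φ x) * (b.1 ⬝ᵥ wgrad Ω k.φ x))
    (fun x ↦ by constructor <;> intros <;> simp <;> ring)
    fun u v ↦ mul (hg2 u) (hg2 v)
  have t10 := hJ.isBilinearMap_integral hJ
    (fun x a b ↦ a.2.1 * (b.1 ⬝ᵥ wgrad Ω k.φ x))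
    (fun x ↦ by constructor <;> intros <;> simp <;> ring)
    fun u v ↦ mul (hd u) (hg2 v)
  have t11 := hJ.isBilinearMap_integral hJ
    (fun x a b ↦ b.2.1 * (a.1 ⬝ᵥ wgrad Ω k.φ x))
    (fun x ↦ by constructor <;> intros <;> simp <;> ring)
    fun u v ↦ mul (hd v) (hg2 u)
  have t12 := hJ.isBilinearMap_integral hJ
    (fun x a b ↦ (a.1 ⨯₃ b.2.2) ⬝ᵥ wgrad Ω k.φ x)
    (fun x ↦ by constructor <;> intros <;> simp)
    fun u v ↦ integrable_dot_of_memLp (cross (hb u) (hc v)) (hg.mono_exponent le_top)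
  have t13 := hJ.isBilinearMap_integral hJ
    (fun x a b ↦ (b.1 ⨯₃ a.2.2) ⬝ᵥ wgrad Ω k.φ x)
    (fun x ↦ by constructor <;> intros <;> simp)
    fun u v ↦ integrable_dot_of_memLp (cross (hb v) (hc u)) (hg.mono_exponent le_top)
  exact isBilinearMap_add (isBilinearMap_add (isBilinearMap_sub (isBilinearMap_add
    (isBilinearMap_add (isBilinearMap_add (isBilinearMap_const_mul t1 p.K₁)
      (isBilinearMap_const_mul t2 p.K₃))
      (isBilinearMap_const_mul (isBilinearMap_add (isBilinearMap_add (isBilinearMap_add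
        (isBilinearMap_add t3 t4) t5) t6) t7) (p.K₂ - p.K₃))) t8)
    (isBilinearMap_const_mul t9 (p.ε₀ * p.εa)))
    (isBilinearMap_const_mul (isBilinearMap_add t10 t11) p.es))
    (isBilinearMap_const_mul (isBilinearMap_add t12 t13) p.eb)

lemma isBilinearMap_mixedForm (hΩ : IsOpen Ω)
    {V : Submodule ℝ (Plane → Vec)} (hV : ∀ v ∈ V, IsHDC Ω v)
    (hVb : ∀ v ∈ V, MemLp v ∞ (volume.restrict Ω)) {Φ : Submodule ℝ (Lp ℝ 2 (volume.restrict Ω))}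
    (hΦ : ∀ ψ ∈ Φ, IsH1 Ω ψ) (p : Material)
    {k : Iterate} (hn : IsHDC Ω k.n) (hnb : MemLp k.n ∞ (volume.restrict Ω))
    (hg : MemLp (wgrad Ω k.φ) ∞ (volume.restrict Ω)) :
    IsBilinearMap ℝ fun (v : V) (ψ : Φ) ↦
      mixedForm p Ω k v (ψ : Lp ℝ 2 (volume.restrict Ω)) := by
  have hJ := isAELinear_jet hΩ hV
  have hD := isAELinear_wgrad hΩ hΦ
  have hd : ∀ v : V, MemLp (wdiv Ω (v : Plane → Vec)) 2 (volume.restrict Ω) := fun v ↦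
    (hV v v.2).memLp_wdiv
  have hc : ∀ v : V, MemLp (wcurl Ω (v : Plane → Vec)) 2 (volume.restrict Ω) := fun v ↦
    (hV v v.2).memLp_wcurl
  have hv : ∀ v : V, MemLp (v : Plane → Vec) 2 (volume.restrict Ω) := fun v ↦ (hV v v.2).1
  have hb : ∀ v : V, MemLp (v : Plane → Vec) ∞ (volume.restrict Ω) := fun v ↦ hVb v v.2
  have hψ : ∀ ψ : Φ, MemLp (wgrad Ω (ψ : Lp ℝ 2 (volume.restrict Ω))) 2 (volume.restrict Ω) :=
    fun ψ ↦ (hΦ ψ ψ.2).memLp_wgrad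
  have mul {f g : Plane → ℝ} (hf : MemLp f 2 (volume.restrict Ω))
      (hg : MemLp g 2 (volume.restrict Ω)) := integrable_mul_of_memLp hf hg
  have dot {f g : Plane → Vec} (hf : MemLp f ∞ (volume.restrict Ω))
      (hg : MemLp g 2 (volume.restrict Ω)) : MemLp (fun x ↦ f x ⬝ᵥ g x) 2 (volume.restrict Ω) :=
    memLp_dot (p := ∞) (q := 2) hf hg
  have dot' {f g : Plane → Vec} (hf : MemLp f 2 (volume.restrict Ω))
      (hg : MemLp g ∞ (volume.restrict Ω)) : MemLp (fun x ↦ f x ⬝ᵥ g x) 2 (volume.restrict Ω) :=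
    memLp_dot (p := 2) (q := ∞) hf hg
  have cross {f g : Plane → Vec} (hf : MemLp f ∞ (volume.restrict Ω))
      (hg : MemLp g 2 (volume.restrict Ω)) : MemLp (fun x ↦ f x ⨯₃ g x) 2 (volume.restrict Ω) :=
    memLp_cross (p := ∞) (q := 2) hf hg
  have t1 := hJ.isBilinearMap_integral hD
    (fun x a b ↦ (k.n x ⬝ᵥ wgrad Ω k.φ x) * (a.1 ⬝ᵥ b))
    (fun x ↦ by constructor <;> intros <;> simp <;> ring)
    fun v ψ ↦ mul (dot' hn.1 hg) (dot (hb v) (hψ ψ))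
  have t2 := hJ.isBilinearMap_integral hD
    (fun x a b ↦ (a.1 ⬝ᵥ wgrad Ω k.φ x) * (k.n x ⬝ᵥ b))
    (fun x ↦ by constructor <;> intros <;> simp <;> ring)
    fun v ψ ↦ mul (dot' (hv v) hg) (dot hnb (hψ ψ))
  have t3 := hJ.isBilinearMap_integral hD (fun x a b ↦ a.2.1 * (k.n x ⬝ᵥ b))
    (fun x ↦ by constructor <;> intros <;> simp <;> ring)
    fun v ψ ↦ mul (hd v) (dot hnb (hψ ψ))
  have t4 := hJ.isBilinearMap_integral hD (fun x a b ↦ wdiv Ω k.n x * (a.1 ⬝ᵥ b))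
    (fun x ↦ by constructor <;> intros <;> simp <;> ring)
    fun v ψ ↦ mul hn.memLp_wdiv (dot (hb v) (hψ ψ))
  have t5 := hJ.isBilinearMap_integral hD (fun x a b ↦ (k.n x ⨯₃ a.2.2) ⬝ᵥ b)
    (fun x ↦ by constructor <;> intros <;> simp)
    fun v ψ ↦ integrable_dot_of_memLp (cross hnb (hc v)) (hψ ψ)
  have t6 := hJ.isBilinearMap_integral hD (fun x a b ↦ (a.1 ⨯₃ wcurl Ω k.n x) ⬝ᵥ b)
    (fun x ↦ by constructor <;> intros <;> simp)
    fun v ψ ↦ integrable_dot_of_memLp (cross (hb v) hn.memLp_wcurl) (hψ ψ)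
  exact isBilinearMap_add (isBilinearMap_add (isBilinearMap_sub
    (isBilinearMap_const_mul t1 (-p.ε₀ * p.εa)) (isBilinearMap_const_mul t2 (p.ε₀ * p.εa)))
    (isBilinearMap_const_mul (isBilinearMap_add t3 t4) p.es))
    (isBilinearMap_const_mul (isBilinearMap_add t5 t6) p.eb)

lemma isBilinearMap_cForm (hΩ : IsOpen Ω) {Φ : Submodule ℝ (Lp ℝ 2 (volume.restrict Ω))}
    (hΦ : ∀ ψ ∈ Φ, IsH1 Ω ψ) (p : Material) {k : Iterate}
    (hnb : MemLp k.n ∞ (volume.restrict Ω)) :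
    IsBilinearMap ℝ fun χ ψ : Φ ↦ cForm p Ω k (χ : Lp ℝ 2 (volume.restrict Ω))
      (ψ : Lp ℝ 2 (volume.restrict Ω)) := by
  have hD := isAELinear_wgrad hΩ hΦ
  have hψ : ∀ ψ : Φ, MemLp (wgrad Ω (ψ : Lp ℝ 2 (volume.restrict Ω))) 2 (volume.restrict Ω) :=
    fun ψ ↦ (hΦ ψ ψ.2).memLp_wgrad
  have t1 := hD.isBilinearMap_integral hD (fun _ a b ↦ a ⬝ᵥ b)
    (fun x ↦ by constructor <;> intros <;> simp)
    fun χ ψ ↦ integrable_dot_of_memLp (hψ χ) (hψ ψ)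
  have t2 := hD.isBilinearMap_integral hD (fun x a b ↦ (k.n x ⬝ᵥ a) * (k.n x ⬝ᵥ b))
    (fun x ↦ by constructor <;> intros <;> simp <;> ring)
    fun χ ψ ↦ integrable_mul_of_memLp (memLp_dot (p := ∞) (q := 2) hnb (hψ χ))
      (memLp_dot (p := ∞) (q := 2) hnb (hψ ψ))
  exact isBilinearMap_add (isBilinearMap_const_mul t1 (p.ε₀ * p.εperp))
    (isBilinearMap_const_mul t2 (p.ε₀ * p.εa))

lemma isBilinearMap_bForm (hΩ : IsOpen Ω)
    {V : Submodule ℝ (Plane → Vec)} (hV : ∀ v ∈ V, IsHDC Ω v)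
    {Γ : Submodule ℝ (Lp ℝ 2 (volume.restrict Ω))} {k : Iterate}
    (hnb : MemLp k.n ∞ (volume.restrict Ω)) :
    IsBilinearMap ℝ fun (v : V) (γ : Γ) ↦ bForm Ω k v (γ : Lp ℝ 2 (volume.restrict Ω)) :=
  (isAELinear_jet hΩ hV).isBilinearMap_integral isAELinear_coe
    (fun x a b ↦ b * (k.n x ⬝ᵥ a.1))
    (fun x ↦
      { add_left := fun a a' b ↦ by simp [mul_add]
        smul_left := fun r a b ↦ by simp; ring
        add_right := fun a b b' ↦ add_mul _ _ _
        smul_right := fun r a b ↦ mul_assoc _ _ _ })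
    fun v γ ↦ integrable_mul_of_memLp (Lp.memLp (γ : Lp ℝ 2 (volume.restrict Ω)))
      (memLp_dot (p := ∞) (q := 2) hnb (hV v v.2).1)

end Forms

/-! ### Invertibility of saddle-point matrices -/

/-- A saddle-point matrix with definite diagonal blocks of opposite sign and an injective
constraint block is invertible. Pairing a kernel vector `(x, y, z)` with `(x, -y, -z)` cancels the
off-diagonal blocks and leaves `a x x + c y y = 0`. -/
lemma isUnit_saddle {ι₁ ι₂ ι₃ X Y Z : Type*} [Fintype ι₁] [Fintype ι₂] [Fintype ι₃]
    [DecidableEq ι₁] [DecidableEq ι₂] [DecidableEq ι₃] [AddCommGroup X] [Module ℝ X]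
    [AddCommGroup Y] [Module ℝ Y] [AddCommGroup Z] [Module ℝ Z]
    (v : Module.Basis ι₁ ℝ X) (ψ : Module.Basis ι₂ ℝ Y) (γ : Module.Basis ι₃ ℝ Z)
    (a : X →ₗ[ℝ] X →ₗ[ℝ] ℝ) (d : X →ₗ[ℝ] Y →ₗ[ℝ] ℝ) (b : X →ₗ[ℝ] Z →ₗ[ℝ] ℝ)
    (c : Y →ₗ[ℝ] Y →ₗ[ℝ] ℝ) (ha : ∀ x, x ≠ 0 → 0 < a x x) (hc : ∀ y, y ≠ 0 → 0 < c y y)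
    (hb : ∀ z, (∀ x, b x z = 0) → z = 0) :
    IsUnit (Matrix.fromBlocks (Matrix.of fun i j ↦ a (v j) (v i))
      (Matrix.fromCols (Matrix.of fun i j ↦ d (v i) (ψ j)) (Matrix.of fun i j ↦ b (v i) (γ j)))
      (Matrix.fromRows (Matrix.of fun i j ↦ d (v i) (ψ j))ᵀ
        (Matrix.of fun i j ↦ b (v i) (γ j))ᵀ)
      (Matrix.fromBlocks (-(Matrix.of fun i j ↦ c (ψ j) (ψ i))) 0 0 0)) := by
  rw [← Matrix.mulVec_injective_iff_isUnit, ← Matrix.coe_mulVecLin, injective_iff_map_eq_zero]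
  intro w hw
  set x : ι₁ → ℝ := fun i ↦ w (.inl i)
  set y : ι₂ → ℝ := fun i ↦ w (.inr (.inl i))
  set z : ι₃ → ℝ := fun i ↦ w (.inr (.inr i))
  have hw' : w = Sum.elim x (Sum.elim y z) := by
    funext i
    rcases i with i | i | i <;> rfl
  rw [Matrix.mulVecLin_apply, hw', Matrix.fromBlocks_mulVec] at hw
  simp only [Sum.elim_comp_inl, Sum.elim_comp_inr, Matrix.fromCols_mulVec_sumElim,
    Matrix.fromRows_mulVec, Matrix.fromBlocks_mulVec, Matrix.zero_mulVec, add_zero] at hw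
  have r1 : ∀ i, (∑ j, a (v j) (v i) * x j) + ((∑ j, d (v i) (ψ j) * y j)
      + ∑ j, b (v i) (γ j) * z j) = 0 := fun i ↦ congrFun hw (.inl i)
  have r2 : ∀ i, (∑ j, d (v j) (ψ i) * x j) - ∑ j, c (ψ j) (ψ i) * y j = 0 := fun i ↦ by
    have := congrFun hw (.inr (.inl i))
    simp [Matrix.mulVec, dotProduct] at this
    linarith
  have r3 : ∀ i, ∑ j, b (v j) (γ i) * x j = 0 := fun i ↦ by
    have := congrFun hw (.inr (.inr i))
    simp [Matrix.mulVec, dotProduct] at this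
    linarith
  set x' := ∑ j, x j • v j
  set y' := ∑ j, y j • ψ j
  set z' := ∑ j, z j • γ j
  have e1 : a x' + d.flip y' + b.flip z' = 0 := v.ext fun i ↦ by
    simp only [x', y', z', map_sum, map_smul, LinearMap.add_apply, LinearMap.sum_apply,
      LinearMap.smul_apply, LinearMap.flip_apply, smul_eq_mul, LinearMap.zero_apply, ← r1 i,
      mul_comm, add_assoc]
  have e2 : d x' - c y' = 0 := ψ.ext fun i ↦ by
    simp only [x', y', map_sum, map_smul, LinearMap.sub_apply, LinearMap.sum_apply,
      LinearMap.smul_apply, smul_eq_mul, LinearMap.zero_apply, ← r2 i, mul_comm]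
  have e3 : b x' = 0 := γ.ext fun i ↦ by
    simp only [x', map_sum, map_smul, LinearMap.sum_apply,
      LinearMap.smul_apply, smul_eq_mul, LinearMap.zero_apply, ← r3 i, mul_comm]
  have k1 : ∀ t, a x' t + d t y' + b t z' = 0 := fun t ↦ by
    simpa using LinearMap.congr_fun e1 t
  have k2 : d x' y' = c y' y' := by
    simpa [sub_eq_zero] using LinearMap.congr_fun e2 y'
  have k3 : b x' z' = 0 := by simpa using LinearMap.congr_fun e3 z'
  have key : a x' x' + c y' y' = 0 := by
    have := k1 x'
    rw [k2, k3, add_zero] at this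
    exact this
  have hx0 : x' = 0 := by
    by_contra h
    have h1 := ha _ h
    have h2 : 0 ≤ c y' y' := by
      by_cases hy : y' = 0
      · simp [hy]
      · exact (hc _ hy).le
    linarith
  have hy0 : y' = 0 := by
    by_contra h
    have h1 := hc _ h
    rw [hx0] at key
    simp at key
    linarith
  have hz0 : z' = 0 := hb _ fun t ↦ by
    have := k1 t
    rw [hx0, hy0] at this
    simpa using this
  have fx := Fintype.linearIndependent_iff.1 v.linearIndependent x hx0
  have fy := Fintype.linearIndependent_iff.1 ψ.linearIndependent y hy0
  have fz := Fintype.linearIndependent_iff.1 γ.linearIndependent z hz0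
  funext i
  rcases i with i | i | i
  exacts [fx i, fy i, fz i]

/-! ### Definiteness of the diagonal blocks -/

lemma dot_self_nonneg (u : Vec) : 0 ≤ u ⬝ᵥ u :=
  Finset.sum_nonneg fun i _ ↦ mul_self_nonneg (u i)

lemma sq_dot_le (u w : Vec) : (u ⬝ᵥ w) ^ 2 ≤ (u ⬝ᵥ u) * (w ⬝ᵥ w) := by
  simp only [dotProduct, ← sq]
  exact Finset.sum_mul_sq_le_sq_mul_sq _ _ _

lemma cross_dot_self_le (u w : Vec) : (u ⨯₃ w) ⬝ᵥ (u ⨯₃ w) ≤ (u ⬝ᵥ u) * (w ⬝ᵥ w) := by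
  rw [cross_dot_cross, dotProduct_comm w u]
  nlinarith [mul_self_nonneg (u ⬝ᵥ w)]

section

variable {Ω : Set Plane}

lemma ae_dot_le_gradSup {φ : Plane → ℝ} (h : gradSup Ω φ < ⊤) :
    ∀ᵐ x ∂(volume.restrict Ω), wgrad Ω φ x ⬝ᵥ wgrad Ω φ x ≤ (gradSup Ω φ).toReal ^ 2 := by
  rw [gradSup, eLpNorm_exponent_top] at *
  filter_upwards [ae_le_eLpNormEssSup (μ := volume.restrict Ω)
    (f := fun x ↦ Real.sqrt (wgrad Ω φ x ⬝ᵥ wgrad Ω φ x))] with x hx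
  have h1 := ENNReal.toReal_mono h.ne hx
  rw [toReal_enorm, Real.norm_of_nonneg (Real.sqrt_nonneg _)] at h1
  calc wgrad Ω φ x ⬝ᵥ wgrad Ω φ x = Real.sqrt (wgrad Ω φ x ⬝ᵥ wgrad Ω φ x) ^ 2 :=
        (Real.sq_sqrt (dot_self_nonneg _)).symm
    _ ≤ _ := by gcongr

lemma norm_le_sqrt_of_dot_le (u : Vec) {C : ℝ} (h : u ⬝ᵥ u ≤ C) : ‖u‖ ≤ Real.sqrt C := by
  refine (pi_norm_le_iff_of_nonneg (Real.sqrt_nonneg _)).2 fun i ↦ ?_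
  refine Real.abs_le_sqrt (le_trans ?_ h)
  rw [sq]
  exact Finset.single_le_sum (f := fun i ↦ u i * u i) (fun i _ ↦ mul_self_nonneg _)
    (Finset.mem_univ i)

lemma IsH1.memLp_top_wgrad {φ : Plane → ℝ} (hφ : IsH1 Ω φ) (h : gradSup Ω φ < ⊤) :
    MemLp (wgrad Ω φ) ∞ (volume.restrict Ω) :=
  memLp_top_of_bound hφ.memLp_wgrad.1 _ ((ae_dot_le_gradSup h).mono fun _ hx ↦
    norm_le_sqrt_of_dot_le _ hx)

lemma memLp_top_of_dot_le (hΩ : IsOpen Ω) {n : Plane → Vec} (hn : ContinuousOn n Ω) {β : ℝ}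
    (hβ : ∀ x ∈ Ω, n x ⬝ᵥ n x ≤ β) : MemLp n ∞ (volume.restrict Ω) :=
  memLp_top_of_bound (hn.aestronglyMeasurable hΩ.measurableSet) (Real.sqrt β)
    ((ae_restrict_iff' hΩ.measurableSet).2 (.of_forall fun x hx ↦ norm_le_sqrt_of_dot_le _ (hβ x hx)))

lemma ipv_self_nonneg (v : Plane → Vec) : 0 ≤ ipv Ω v v :=
  integral_nonneg fun _ ↦ dot_self_nonneg _

lemma ip_self_nonneg (f : Plane → ℝ) : 0 ≤ ip Ω f f :=
  integral_nonneg fun _ ↦ mul_self_nonneg _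

/-- Young's inequality for a product whose second factor is dominated by `C |v|`. -/
lemma abs_mul_le_of_sq_le {s t C V : ℝ} (hC : 0 ≤ C) (ht : t ^ 2 ≤ C ^ 2 * V) (hV : 0 ≤ V) :
    |s * t| ≤ C / 2 * (s * s + V) := by
  have h1 : |t| ≤ C * Real.sqrt V := by
    refine abs_le_of_sq_le_sq ?_ (by positivity)
    rw [mul_pow, Real.sq_sqrt hV]
    exact ht
  rw [abs_mul]
  have h2 := Real.sq_sqrt hV
  have h3 := mul_le_mul_of_nonneg_left h1 (abs_nonneg s)
  have h4 := mul_nonneg hC (sq_nonneg (|s| - Real.sqrt V))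
  nlinarith [abs_mul_abs_self s]

/-- The electric and flexoelectric terms perturb the free elastic form by at most a multiple of the
squared norm of `H(div) ∩ H(curl)`. -/
lemma aForm_self_ge {v : Plane → Vec} (hv : IsHDC Ω v) {φ : Plane → ℝ} (hφ : IsH1 Ω φ)
    (hsup : gradSup Ω φ < ⊤) (p : Material) {k : Iterate} (hk : k.φ = φ) :
    aElastic p Ω k v v - (p.ε₀ * max p.εa 0 * (gradSup Ω φ).toReal ^ 2
      + 2 * (gradSup Ω φ).toReal * (|p.eb| + |p.es|)) * normDCsq Ω v ≤ aForm p Ω k v v := by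
  subst hk
  set C := (gradSup Ω k.φ).toReal
  have hC : 0 ≤ C := ENNReal.toReal_nonneg
  have hae := ae_dot_le_gradSup hsup
  have hg := hφ.memLp_top_wgrad hsup
  have ivv := integrable_dot_of_memLp hv.1 hv.1
  have idd := integrable_mul_of_memLp hv.memLp_wdiv hv.memLp_wdiv
  have icc := integrable_dot_of_memLp hv.memLp_wcurl hv.memLp_wcurl
  have hvg : MemLp (fun x ↦ v x ⬝ᵥ wgrad Ω k.φ x) 2 (volume.restrict Ω) :=
    memLp_dot (p := 2) (q := ∞) hv.1 hg
  have hpt : ∀ᵐ x ∂(volume.restrict Ω), (v x ⬝ᵥ wgrad Ω k.φ x) ^ 2 ≤ C ^ 2 * (v x ⬝ᵥ v x) := by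
    filter_upwards [hae] with x hx
    refine (sq_dot_le _ _).trans ?_
    rw [mul_comm]
    exact mul_le_mul_of_nonneg_right hx (dot_self_nonneg _)
  have h1 : ip Ω (fun x ↦ v x ⬝ᵥ wgrad Ω k.φ x) (fun x ↦ v x ⬝ᵥ wgrad Ω k.φ x)
      ≤ C ^ 2 * ipv Ω v v := by
    rw [ip, ipv, ← integral_const_mul]
    refine integral_mono_ae (integrable_mul_of_memLp hvg hvg) (ivv.const_mul _) ?_
    filter_upwards [hpt] with x hx
    rw [← sq]
    exact hx
  have h2 : |ip Ω (wdiv Ω v) (fun x ↦ v x ⬝ᵥ wgrad Ω k.φ x)|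
      ≤ C / 2 * (ip Ω (wdiv Ω v) (wdiv Ω v) + ipv Ω v v) := by
    rw [ip, ip, ipv, ← integral_add idd ivv, ← integral_const_mul, ← Real.norm_eq_abs]
    refine norm_integral_le_of_norm_le ((idd.add ivv).const_mul _) ?_
    filter_upwards [hpt] with x hx
    exact abs_mul_le_of_sq_le hC hx (dot_self_nonneg _)
  have h3 : |ipv Ω (fun x ↦ v x ⨯₃ wcurl Ω v x) (wgrad Ω k.φ)|
      ≤ C / 2 * (ipv Ω (wcurl Ω v) (wcurl Ω v) + ipv Ω v v) := by
    rw [ipv, ipv, ipv, ← integral_add icc ivv, ← integral_const_mul, ← Real.norm_eq_abs]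
    refine norm_integral_le_of_norm_le ((icc.add ivv).const_mul _) ?_
    filter_upwards [hae] with x hx
    set c := wcurl Ω v x
    have hcc : Real.sqrt (c ⬝ᵥ c) * Real.sqrt (c ⬝ᵥ c) = c ⬝ᵥ c :=
      Real.mul_self_sqrt (dot_self_nonneg _)
    have hsq : ((v x ⨯₃ c) ⬝ᵥ wgrad Ω k.φ x) ^ 2 ≤ C ^ 2 * ((v x ⬝ᵥ v x) * (c ⬝ᵥ c)) :=
      (sq_dot_le _ _).trans (by
        rw [mul_comm]
        exact mul_le_mul hx (cross_dot_self_le _ _) (dot_self_nonneg _) (sq_nonneg _))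
    have hvv := dot_self_nonneg (v x)
    have hb : |(v x ⨯₃ c) ⬝ᵥ wgrad Ω k.φ x|
        ≤ C * (Real.sqrt (v x ⬝ᵥ v x) * Real.sqrt (c ⬝ᵥ c)) := by
      refine abs_le_of_sq_le_sq (hsq.trans_eq ?_) (by positivity)
      rw [mul_pow, mul_pow, Real.sq_sqrt hvv, Real.sq_sqrt (dot_self_nonneg _)]
    refine hb.trans ?_
    have h4 := mul_nonneg hC (sq_nonneg (Real.sqrt (v x ⬝ᵥ v x) - Real.sqrt (c ⬝ᵥ c)))
    nlinarith [Real.mul_self_sqrt hvv]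
  have hV := ipv_self_nonneg (Ω := Ω) v
  have hD := ip_self_nonneg (Ω := Ω) (wdiv Ω v)
  have hR := ipv_self_nonneg (Ω := Ω) (wcurl Ω v)
  have hs : -(|p.es| * (C * normDCsq Ω v)) ≤
      p.es * ip Ω (wdiv Ω v) (fun x ↦ v x ⬝ᵥ wgrad Ω k.φ x) := by
    refine neg_le_of_abs_le ?_
    rw [abs_mul]
    refine mul_le_mul_of_nonneg_left (h2.trans ?_) (abs_nonneg _)
    rw [normDCsq]
    nlinarith [mul_nonneg hC hV, mul_nonneg hC hD, mul_nonneg hC hR]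
  have hbb : -(|p.eb| * (C * normDCsq Ω v)) ≤
      p.eb * ipv Ω (fun x ↦ v x ⨯₃ wcurl Ω v x) (wgrad Ω k.φ) := by
    refine neg_le_of_abs_le ?_
    rw [abs_mul]
    refine mul_le_mul_of_nonneg_left (h3.trans ?_) (abs_nonneg _)
    rw [normDCsq]
    nlinarith [mul_nonneg hC hV, mul_nonneg hC hD, mul_nonneg hC hR]
  have he : p.ε₀ * p.εa * ip Ω (fun x ↦ v x ⬝ᵥ wgrad Ω k.φ x) (fun x ↦ v x ⬝ᵥ wgrad Ω k.φ x)
      ≤ p.ε₀ * max p.εa 0 * (C ^ 2 * normDCsq Ω v) := by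
    have h5 : C ^ 2 * ipv Ω v v ≤ C ^ 2 * normDCsq Ω v := by
      refine mul_le_mul_of_nonneg_left ?_ (sq_nonneg _)
      rw [normDCsq]
      linarith
    have h6 := p.ε₀_pos
    refine mul_le_mul ?_ (h1.trans h5) (ip_self_nonneg _) (by positivity)
    exact mul_le_mul_of_nonneg_left (le_max_left _ _) h6.le
  rw [aForm]
  linarith

/-- The potential form is coercive with respect to the seminorm of the weak gradient. -/
lemma exists_cForm_self_ge (hΩ : IsOpen Ω) (p : Material) {k : Iterate}
    (hnb : MemLp k.n ∞ (volume.restrict Ω)) {β : ℝ} (hβ : ∀ x ∈ Ω, k.n x ⬝ᵥ k.n x ≤ β)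
    (hc : 0 ≤ p.εa ∨ (p.εa < 0 ∧ β < p.εperp / |p.εa|)) :
    ∃ c₀ > 0, ∀ ψ, IsH1 Ω ψ → c₀ * ipv Ω (wgrad Ω ψ) (wgrad Ω ψ) ≤ cForm p Ω k ψ ψ := by
  have h0 := p.ε₀_pos
  have hp := p.εperp_pos
  rcases hc with ha | ⟨ha, hb⟩
  · refine ⟨p.ε₀ * p.εperp, by positivity, fun ψ hψ ↦ ?_⟩
    rw [cForm]
    have := mul_nonneg (mul_nonneg h0.le ha) (ip_self_nonneg (Ω := Ω) fun x ↦ k.n x ⬝ᵥ wgrad Ω ψ x)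
    linarith
  · rw [lt_div_iff₀ (abs_pos.2 ha.ne), abs_of_neg ha] at hb
    refine ⟨p.ε₀ * (p.εperp + β * p.εa), mul_pos h0 (by linarith), fun ψ hψ ↦ ?_⟩
    have hg := hψ.memLp_wgrad
    have hng : MemLp (fun x ↦ k.n x ⬝ᵥ wgrad Ω ψ x) 2 (volume.restrict Ω) :=
      memLp_dot (p := ∞) (q := 2) hnb hg
    have key : ip Ω (fun x ↦ k.n x ⬝ᵥ wgrad Ω ψ x) (fun x ↦ k.n x ⬝ᵥ wgrad Ω ψ x)
        ≤ β * ipv Ω (wgrad Ω ψ) (wgrad Ω ψ) := by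
      rw [ip, ipv, ← integral_const_mul]
      refine integral_mono_ae (integrable_mul_of_memLp hng hng)
        ((integrable_dot_of_memLp hg hg).const_mul _) ?_
      rw [EventuallyLE, ae_restrict_iff' hΩ.measurableSet]
      refine .of_forall fun x hx ↦ ?_
      rw [← sq]
      exact (sq_dot_le _ _).trans (mul_le_mul_of_nonneg_right (hβ x hx) (dot_self_nonneg _))
    rw [cForm]
    nlinarith [mul_le_mul_of_nonneg_left key (mul_nonneg h0.le (neg_nonneg.2 ha.le))]

lemma ae_eq_zero_of_ipv_self {g : Plane → Vec} (hg : MemLp g 2 (volume.restrict Ω))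
    (h : ipv Ω g g = 0) : g =ᵐ[volume.restrict Ω] 0 := by
  rw [ipv, integral_eq_zero_iff_of_nonneg (fun x ↦ dot_self_nonneg _)
    (integrable_dot_of_memLp hg hg)] at h
  filter_upwards [h] with x hx
  exact dotProduct_self_eq_zero.1 hx

lemma norm_fderiv_le {η : Plane → ℝ} (x : Plane) : ‖fderiv ℝ η x‖ ≤ 2 * ‖cgrad η x‖ := by
  refine ContinuousLinearMap.opNorm_le_bound _ (by positivity) fun y ↦ ?_
  have hy : y = y 0 • EuclideanSpace.single 0 (1 : ℝ) + y 1 • EuclideanSpace.single 1 (1 : ℝ) := by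
    ext i
    fin_cases i <;> simp
  have h0 : ‖pd 0 η x‖ ≤ ‖cgrad η x‖ := norm_le_pi_norm (cgrad η x) 0
  have h1 : ‖pd 1 η x‖ ≤ ‖cgrad η x‖ := norm_le_pi_norm (cgrad η x) 1
  have e : fderiv ℝ η x y = y 0 * pd 0 η x + y 1 * pd 1 η x := by
    conv_lhs => rw [hy]
    simp only [map_add, map_smul, smul_eq_mul, pd]
  rw [e]
  refine (norm_add_le _ _).trans ?_
  rw [norm_mul, norm_mul]
  have k0 := PiLp.norm_apply_le y 0
  have k1 := PiLp.norm_apply_le y 1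
  nlinarith [mul_le_mul k0 h0 (norm_nonneg _) (norm_nonneg _),
    mul_le_mul k1 h1 (norm_nonneg _) (norm_nonneg _)]

/-- A function in `H¹₀(Ω)` with vanishing weak gradient vanishes, by the
Gagliardo–Nirenberg–Sobolev inequality for the approximating test functions. -/
lemma IsH10.ae_eq_zero (hΩb : Bornology.IsBounded Ω) {ψ : Plane → ℝ} (h : IsH10 Ω ψ)
    (hg : wgrad Ω ψ =ᵐ[volume.restrict Ω] 0) : ψ =ᵐ[volume.restrict Ω] 0 := by
  have hfin : volume Ω < ⊤ := hΩb.measure_lt_top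
  obtain ⟨⟨hψ, _⟩, η, hη, h1, h2⟩ := h
  have h2' : Tendsto (fun j ↦ eLpNorm (cgrad (η j)) 2 (volume.restrict Ω)) atTop (𝓝 0) := by
    refine h2.congr fun j ↦ eLpNorm_congr_ae ?_
    filter_upwards [hg] with x hx
    simp [hx]
  set K : ℝ≥0 := eLpNormLESNormFDerivOneConst (volume : Measure Plane) 2
  set A : ℝ≥0∞ := (volume.restrict Ω) Set.univ ^ (1 / (1 : ℝ≥0∞).toReal - 1 / (2 : ℝ≥0∞).toReal)
  have hA : A ≠ ⊤ := ENNReal.rpow_ne_top_of_nonneg (by norm_num) (by simpa using hfin.ne)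
  have hle : ∀ j, eLpNorm (η j) 2 (volume.restrict Ω) ≤
      K * (2 * (eLpNorm (cgrad (η j)) 2 (volume.restrict Ω) * A)) := by
    intro j
    have hsupp : Function.support (fderiv ℝ (η j)) ⊆ Ω :=
      (support_fderiv_subset ℝ).trans (hη j).2.2
    have hGNS := eLpNorm_le_eLpNorm_fderiv_one (volume : Measure Plane)
      ((hη j).1.of_le (by simp)) (hη j).2.1 (p := 2)
      (by simpa using NNReal.HolderConjugate.two_two)
    refine (eLpNorm_mono_measure _ Measure.restrict_le_self).trans (hGNS.trans ?_)
    refine mul_le_mul_right ?_ _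
    rw [← eLpNorm_restrict_eq_of_support_subset (f := fderiv ℝ (η j)) hsupp]
    refine (eLpNorm_le_mul_eLpNorm_of_ae_le_mul (.of_forall norm_fderiv_le) 1).trans ?_
    rw [ENNReal.ofReal_ofNat]
    refine mul_le_mul_right ?_ _
    exact eLpNorm_le_eLpNorm_mul_rpow_measure_univ (by norm_num) ((hη j).memLp_cgrad 2).1
  have hη0 : Tendsto (fun j ↦ eLpNorm (η j) 2 (volume.restrict Ω)) atTop (𝓝 0) := by
    refine tendsto_of_tendsto_of_tendsto_of_le_of_le tendsto_const_nhds ?_ (fun _ ↦ zero_le)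
      hle
    have t1 := ENNReal.Tendsto.mul_const h2' (b := A) (.inr hA)
    have t2 := ENNReal.Tendsto.const_mul t1 (a := 2) (.inr (by simp))
    have t3 := ENNReal.Tendsto.const_mul t2 (a := K) (.inr (by simp [K]))
    simpa using t3
  have hsum : ∀ j, eLpNorm ψ 2 (volume.restrict Ω) ≤ eLpNorm (η j) 2 (volume.restrict Ω)
      + eLpNorm (fun x ↦ η j x - ψ x) 2 (volume.restrict Ω) := fun j ↦ by
    have := eLpNorm_sub_le (p := 2) ((hη j).memLp 2).1 (((hη j).memLp 2).sub hψ).1 (by norm_num)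
    refine le_trans (le_of_eq ?_) this
    congr 1
    funext x
    simp
  have hz : eLpNorm ψ 2 (volume.restrict Ω) ≤ 0 + 0 :=
    ge_of_tendsto' (hη0.add h1) hsum
  rw [add_zero, nonpos_iff_eq_zero, eLpNorm_eq_zero_iff hψ.1 (by norm_num)] at hz
  exact hz

end

/-! ### The constraint block -/

lemma mem_Vh_of_isBubble {τ : Type*} {Ω : Set Plane} {P : τ → Fin 4 → Plane} {m : ℕ}
    {n w : Plane → Vec} (hw : IsBubble Ω P n w) (h0 : ∀ x ∉ Ω, w x = 0) : w ∈ Vh Ω P m n := by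
  refine ⟨h0, 0, w, fun i ↦ ⟨continuousOn_const, fun T ↦ ⟨0, fun s _ ↦ ?_⟩⟩, hw, fun x _ ↦ ?_⟩ <;>
    simp [qPoly]

/-- The bubbles control the multipliers: testing with the bubble field of a single cell shows that
a multiplier annihilated by all director fields vanishes on that cell. -/
lemma eq_zero_of_bForm_eq_zero {τ : Type*} [Finite τ] {Ω : Set Plane} (hΩ : IsOpen Ω)
    {P : τ → Fin 4 → Plane} (hP : IsQuadMesh Ω P) {m : ℕ} {k : Iterate}
    (hn : ContinuousOn k.n Ω) (hn2 : MemLp k.n 2 (volume.restrict Ω)) (hn0 : ∀ x ∈ Ω, k.n x ≠ 0)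
    {β : ℝ} (hβ : ∀ x ∈ Ω, k.n x ⬝ᵥ k.n x ≤ β) {γ : Lp ℝ 2 (volume.restrict Ω)}
    (hγ : γ ∈ P0 Ω P) (h : ∀ v ∈ Vh Ω P m k.n, bForm Ω k v γ = 0) : γ = 0 := by
  have hcell : ∀ T, ∀ᵐ x ∂(volume.restrict Ω), x ∈ openCell (P T) → γ x = 0 := by
    intro T
    have hq := hP.isQuad T
    obtain ⟨r, hr⟩ := hγ T
    suffices hr0 : r = 0 by simpa [hr0] using hr
    obtain ⟨K, hK⟩ := hq.exists_lipschitzWith_bubble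
    have hb0 : ∀ x ∉ Ω, bubble (P T) x = 0 := fun x hx ↦
      hq.bubble_eq_zero fun h ↦ hx (hP.open_subset T h)
    have hbc : HasCompactSupport (bubble (P T)) := HasCompactSupport.intro (isCompact_cell (P T))
      fun x hx ↦ hq.bubble_eq_zero fun h ↦ hx (openCell_subset_cell _ h)
    have hbn := isBubble_bubble hP hΩ hn (fun x hx ↦ norm_le_sqrt_of_dot_le _ (hβ x hx)) T
    have h1 := h _ (mem_Vh_of_isBubble hbn fun x hx ↦ by simp [hb0 x hx])
    have h2 : bForm Ω k (fun x ↦ bubble (P T) x • k.n x) γ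
        = r * ∫ x in Ω, bubble (P T) x * (k.n x ⬝ᵥ k.n x) := by
      rw [bForm, ← integral_const_mul]
      refine integral_congr_ae ?_
      filter_upwards [hr] with x hx
      rw [dotProduct_smul, smul_eq_mul]
      by_cases hxT : x ∈ openCell (P T)
      · rw [hx hxT]
      · simp [hq.bubble_eq_zero hxT]
    rw [h1] at h2
    by_contra hr0
    have h3 := (mul_eq_zero.1 h2.symm).resolve_left hr0
    have hnn : ∀ x, 0 ≤ bubble (P T) x * (k.n x ⬝ᵥ k.n x) := fun x ↦ by
      refine mul_nonneg ?_ (dot_self_nonneg _)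
      by_cases hxT : x ∈ openCell (P T)
      · exact (hq.bubble_pos hxT).le
      · rw [hq.bubble_eq_zero hxT]
    have hint : Integrable (fun x ↦ bubble (P T) x * (k.n x ⬝ᵥ k.n x)) (volume.restrict Ω) :=
      memLp_one_iff_integrable.1 (memLp_mul (p := ∞) (q := 1)
        (hK.continuous.memLp_of_hasCompactSupport hbc)
        (memLp_one_iff_integrable.2 (integrable_dot_of_memLp hn2 hn2)))
    rw [integral_eq_zero_iff_of_nonneg hnn hint, EventuallyEq,
      ae_restrict_iff' hΩ.measurableSet] at h3
    have h4 : volume (openCell (P T)) = 0 := by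
      rw [measure_eq_zero_iff_ae_notMem]
      filter_upwards [h3] with x hx hxT
      have hxΩ := hP.open_subset T hxT
      have := mul_eq_zero.1 (hx hxΩ)
      rcases this with h | h
      · exact (hq.bubble_pos hxT).ne' h
      · exact hn0 x hxΩ (dotProduct_self_eq_zero.1 h)
    exact (hq.isOpen_openCell.measure_pos volume (refSquareOpen_nonempty.image _)).ne' h4
  rw [Lp.eq_zero_iff_ae_eq_zero]
  filter_upwards [hP.ae_mem_openCell hΩ, ae_all_iff.2 hcell] with x ⟨T, hT⟩ hx
  exact hx T hT

end Flexo

end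

theorem theorem5p2
    -- the domain
    (Ω : Set Flexo.Plane) (hΩo : IsOpen Ω) (hΩc : IsConnected Ω) (hΩb : Bornology.IsBounded Ω)
    -- material constants and the current iterate
    (p : Flexo.Material) (k : Flexo.Iterate)
    (hn : Flexo.IsHDC Ω k.n) (hφ : Flexo.IsH1 Ω k.φ) (hlam : MemLp k.lam 2 (volume.restrict Ω))
    (hncont : ContinuousOn k.n Ω) (hn0 : ∀ x ∈ Ω, k.n x ≠ 0)
    (β : ℝ) (hβ : ∀ x ∈ Ω, k.n x ⬝ᵥ k.n x ≤ β)
    (hφsup : Flexo.gradSup Ω k.φ < ⊤)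
    -- quadrilateral subdivision and discrete spaces
    {τ : Type*} [Finite τ] (P : τ → Fin 4 → Flexo.Plane) (hP : Flexo.IsQuadMesh Ω P)
    (m : ℕ) (hm : 1 ≤ m)
    (Φh : Submodule ℝ (Lp ℝ 2 (volume.restrict Ω))) (hΦh : ∀ ψ ∈ Φh, Flexo.IsH10 Ω ψ)
    -- assumption for the potential block
    (hc : 0 ≤ p.εa ∨ (p.εa < 0 ∧ β < p.εperp / |p.εa|))
    -- coercivity constant of the free elastic form, and its size
    (α₀ : ℝ) (hα₀ : 0 < α₀)
    (hel : ∀ v ∈ Flexo.Vh Ω P m k.n, α₀ * Flexo.normDCsq Ω v ≤ Flexo.aElastic p Ω k v v)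
    (hsmall :
      (p.εa ≤ 0 ∧ 2 * (Flexo.gradSup Ω k.φ).toReal * (|p.eb| + |p.es|) < α₀) ∨
      (0 < p.εa ∧ p.ε₀ * p.εa * (Flexo.gradSup Ω k.φ).toReal ^ 2
        + 2 * (Flexo.gradSup Ω k.φ).toReal * (|p.eb| + |p.es|) < α₀))
    -- finite bases of the three discrete spaces
    {ι₁ ι₂ ι₃ : Type*} [Fintype ι₁] [Fintype ι₂] [Fintype ι₃]
    [DecidableEq ι₁] [DecidableEq ι₂] [DecidableEq ι₃]
    (v : Module.Basis ι₁ ℝ (Flexo.Vh Ω P m k.n)) (ψ : Module.Basis ι₂ ℝ Φh)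
    (γ : Module.Basis ι₃ ℝ (Flexo.P0 Ω P)) :
    IsUnit (Flexo.Mbar p Ω k (fun i ↦ (v i : Flexo.Plane → Flexo.Vec))
      (fun i ↦ ((ψ i : Lp ℝ 2 (volume.restrict Ω)) : Flexo.Plane → ℝ))
      (fun i ↦ ((γ i : Lp ℝ 2 (volume.restrict Ω)) : Flexo.Plane → ℝ))) := by
  have hfin : IsFiniteMeasure (volume.restrict Ω) := ⟨by simpa using hΩb.measure_lt_top⟩
  have hV : ∀ u ∈ Flexo.Vh Ω P m k.n, Flexo.IsHDC Ω u := fun u hu ↦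
    Flexo.isHDC_of_mem_Vh hP hΩo hΩb hn hu
  have hVb : ∀ u ∈ Flexo.Vh Ω P m k.n, MemLp u ∞ (volume.restrict Ω) := fun u hu ↦
    Flexo.memLp_top_of_mem_Vh hΩo hΩb hu
  have hΦ : ∀ χ ∈ Φh, Flexo.IsH1 Ω χ := fun χ hχ ↦ (hΦh χ hχ).1
  have hnb := Flexo.memLp_top_of_dot_le hΩo hncont hβ
  have hg := hφ.memLp_top_wgrad hφsup
  have ba := Flexo.isBilinearMap_aForm hΩo hV hVb p hn hnb hlam hg
  have bd := Flexo.isBilinearMap_mixedForm hΩo hV hVb hΦ p hn hnb hg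
  have bb := Flexo.isBilinearMap_bForm (Γ := Flexo.P0 Ω P) hΩo hV hnb
  have bc := Flexo.isBilinearMap_cForm hΩo hΦ p hnb
  obtain ⟨c₀, hc₀, hcoer⟩ := Flexo.exists_cForm_self_ge hΩo p hnb hβ hc
  -- both cases of the smallness assumption say that `α₀` exceeds the size of the perturbation
  have hsmall' : p.ε₀ * max p.εa 0 * (Flexo.gradSup Ω k.φ).toReal ^ 2
      + 2 * (Flexo.gradSup Ω k.φ).toReal * (|p.eb| + |p.es|) < α₀ := by
    rcases hsmall with ⟨h1, h2⟩ | ⟨h1, h2⟩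
    · simpa [max_eq_right h1] using h2
    · simpa [max_eq_left h1.le] using h2
  refine Flexo.isUnit_saddle v ψ γ ba.toLinearMap bd.toLinearMap bb.toLinearMap bc.toLinearMap
    (fun u hu ↦ ?_) (fun χ hχ ↦ ?_) (fun z hz ↦ ?_)
  · change 0 < Flexo.aForm p Ω k u u
    have h1 := Flexo.aForm_self_ge (hV u u.2) hφ hφsup p (k := k) rfl
    have h2 := hel u u.2
    have hpos : 0 < Flexo.ipv Ω (u : Flexo.Plane → Flexo.Vec) u := by
      refine (Flexo.ipv_self_nonneg _).lt_of_ne' fun h0 ↦ hu (Subtype.ext ?_)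
      have hae := Flexo.ae_eq_zero_of_ipv_self (hV u u.2).1 h0
      have heq := Measure.eqOn_open_of_ae_eq hae hΩo
        ((Flexo.Vh_continuousOn u.2).mono subset_closure) continuousOn_const
      funext x
      by_cases hx : x ∈ Ω
      · exact heq hx
      · exact u.2.1 x hx
    have hN : 0 < Flexo.normDCsq Ω (u : Flexo.Plane → Flexo.Vec) := by
      have h3 := Flexo.ip_self_nonneg (Ω := Ω) (Flexo.wdiv Ω (u : Flexo.Plane → Flexo.Vec))
      have h4 := Flexo.ipv_self_nonneg (Ω := Ω) (Flexo.wcurl Ω (u : Flexo.Plane → Flexo.Vec))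
      rw [Flexo.normDCsq]
      linarith
    have h5 := mul_pos (sub_pos.2 hsmall') hN
    linarith
  · change 0 < Flexo.cForm p Ω k (χ : Lp ℝ 2 (volume.restrict Ω)) (χ : Lp ℝ 2 (volume.restrict Ω))
    refine lt_of_lt_of_le (mul_pos hc₀ ?_) (hcoer _ (hΦ χ χ.2))
    refine (Flexo.ipv_self_nonneg _).lt_of_ne' fun h0 ↦ hχ (Subtype.ext ?_)
    have hae := Flexo.ae_eq_zero_of_ipv_self (hΦ χ χ.2).memLp_wgrad h0
    exact Lp.eq_zero_iff_ae_eq_zero.2 ((hΦh χ χ.2).ae_eq_zero hΩb hae)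
  · exact Subtype.ext (Flexo.eq_zero_of_bForm_eq_zero hΩo hP hncont hn.1 hn0 hβ z.2
      fun u hu ↦ hz ⟨u, hu⟩)
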